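/- Let $\hat{\mathbb C}=\mathbb C\cup\{\infty\}$. A \emph{domain} is an open connected subset of $\hat{\mathbb C}$; its \emph{boundary components} are the boundaries of the connected components of its complement; it is \emph{finitely connected} if these components are finitely many, \emph{non-degenerate} if each of them has at least two points, and \emph{circular} if its boundary components are circles. For a finitely connected, non-degenerate domain $D$ with $\infty\in D$ and $0\notin D$, let $C_D$ be the circular domain, and $f_D$ the conformal map of $D$ onto $C_D$, such that $f_D(z)=z+O(z^{-1})$ as $z\to\infty$ (by Koebe's theorem both exist and are unique). Call \emph{basic} the open rectangles with sides parallel to the axes and rational vertices and the sets $\hat{\mathbb C}\setminus\overline{D_r(0)}$ with $r>0$ rational, and code them effectively by natural numbers. A \emph{name} of a point $z\in\hat{\mathbb C}$ is an infinite sequence that lists (the codes of) all basic sets containing $z$; a name of an open set $U$ lists all basic sets whose closures are contained in $U$; a name of a closed set $K$ lists all basic sets that intersect $K$. A name of a function $f:\subseteq\hat{\mathbb C}\to\hat{\mathbb C}$ consists of a set $X\subseteq\mathbb N$ and a code of a Turing machine which, with oracle $X$, transforms every name of every $z\in\operatorname{dom}(f)$ into a name of $f(z)$, running indefinitely and writing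 on a one-way output tape. \textbf{Theorem.} From a name of a finitely connected, non-degenerate domain $D$ that contains $\infty$ but not $0$, the number of its boundary components, a name of $f_D$, and a name of $\partial C_D$, one can uniformly compute a name of $\partial D$ (and of $\partial C_D$); that is, there are fixed machines which, for all such $D$ and all such names, transform these data into a name of $\partial D$ and a name of $\partial C_D$, respectively. -/

import Mathlib

open scoped OnePoint

noncomputable section

namespace SphereTTE

/-- The extended complex plane. -/
abbrev Sphere : Type := OnePoint ℂ

/-! ### Machines

Programs for Turing machines with an oracle: the syntax of `Nat.Partrec.Code` together with one
instruction that queries the oracle. -/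

/-- Programs of oracle machines. -/
inductive OracleCode : Type
  | zero : OracleCode
  | succ : OracleCode
  | left : OracleCode
  | right : OracleCode
  | oracle : OracleCode
  | pair : OracleCode → OracleCode → OracleCode
  | comp : OracleCode → OracleCode → OracleCode
  | prec : OracleCode → OracleCode → OracleCode
  | rfind' : OracleCode → OracleCode

namespace OracleCode

/-- The partial function computed by a program with access to `O`. Each clause is the one of
`Nat.Partrec.Code.eval`, and `oracle` returns the queried value of `O`. -/
def eval (O : ℕ → ℕ) : OracleCode → ℕ →. ℕ
  | zero => pure 0
  | succ => Nat.succ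
  | left => ↑fun n : ℕ => n.unpair.1
  | right => ↑fun n : ℕ => n.unpair.2
  | oracle => ↑O
  | pair cf cg => fun n => Nat.pair <$> eval O cf n <*> eval O cg n
  | comp cf cg => fun n => eval O cg n >>= eval O cf
  | prec cf cg =>
    Nat.unpaired fun a n =>
      n.rec (eval O cf a) fun y IH => do
        let i ← IH
        eval O cg (Nat.pair a (Nat.pair y i))
  | rfind' cf =>
    Nat.unpaired fun a m =>
      (Nat.rfind fun n => (fun m => m = 0) <$> eval O cf (Nat.pair a (n + m))).map (· + m)

/-- The number that codes a program (following `Nat.Partrec.Code.encodeCode`). -/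
def encode : OracleCode → ℕ
  | zero => 0
  | succ => 1
  | left => 2
  | right => 3
  | oracle => 4
  | pair cf cg => 2 * (2 * Nat.pair (encode cf) (encode cg)) + 5
  | comp cf cg => 2 * (2 * Nat.pair (encode cf) (encode cg) + 1) + 5
  | prec cf cg => (2 * (2 * Nat.pair (encode cf) (encode cg)) + 1) + 5
  | rfind' cf => (2 * (2 * encode cf + 1) + 1) + 5

/-- When the infinite sequence `O` is on its input tape, the machine with program `c`, running
indefinitely, writes the infinite sequence `s` on its output tape: it delivers each cell `s k`. -/
def Writes (c : OracleCode) (O s : ℕ → ℕ) : Prop :=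
  ∀ k, c.eval O k = Part.some (s k)

end OracleCode

/-- Two infinite sequences on one tape, `p` on the even cells and `q` on the odd cells. -/
def join (p q : ℕ → ℕ) : ℕ → ℕ := fun k => if k % 2 = 0 then p (k / 2) else q (k / 2)

/-- The sequence `p` lists the set `S`: the cell content `n + 1` lists the number `n`, and the
content `0` lists nothing (so that the empty set has a list as well). -/
def Lists (p : ℕ → ℕ) (S : Set ℕ) : Prop :=
  ∀ n, n ∈ S ↔ ∃ k, p k = n + 1

/-! ### Basic open sets and their codes -/

/-- The rational number with code `k`; every rational number has a code. -/
def ratOf (k : ℕ) : ℚ :=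
  ((k.unpair.1.unpair.1 : ℚ) - (k.unpair.1.unpair.2 : ℚ)) / ((k.unpair.2 : ℚ) + 1)

/-- The positive rational number with code `k`; every positive rational number has a code. -/
def posRatOf (k : ℕ) : ℚ :=
  ((k.unpair.1 : ℚ) + 1) / ((k.unpair.2 : ℚ) + 1)

/-- The open rectangle with lower left corner `x + iy`, width `w` and height `h`. -/
def rectangle (x y w h : ℚ) : Set Sphere :=
  (fun z : ℂ => (z : Sphere)) ''
    {z : ℂ | (x : ℝ) < z.re ∧ z.re < (x : ℝ) + (w : ℝ) ∧
      (y : ℝ) < z.im ∧ z.im < (y : ℝ) + (h : ℝ)}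

/-- The complement in the sphere of the closed disk with center `0` and radius `r`. -/
def diskExterior (r : ℚ) : Set Sphere :=
  ((fun z : ℂ => (z : Sphere)) '' Metric.closedBall (0 : ℂ) (r : ℝ))ᶜ

/-- The basic open set with code `k`: even codes are the codes of the rational rectangles, odd
codes those of the disk exteriors with positive rational radius. -/
def basicSet (k : ℕ) : Set Sphere :=
  if k % 2 = 0 then
    rectangle (ratOf (k / 2).unpair.1.unpair.1) (ratOf (k / 2).unpair.1.unpair.2)
      (posRatOf (k / 2).unpair.2.unpair.1) (posRatOf (k / 2).unpair.2.unpair.2)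
  else diskExterior (posRatOf (k / 2))

/-! ### Naming systems -/

/-- A name of a point is a list of all the basic sets that contain it. -/
def NamesPoint (p : ℕ → ℕ) (z : Sphere) : Prop :=
  Lists p {k | z ∈ basicSet k}

/-- A name of an open set is a list of all the basic sets whose closures it contains. -/
def NamesOpen (p : ℕ → ℕ) (U : Set Sphere) : Prop :=
  Lists p {k | closure (basicSet k) ⊆ U}

/-- A name of a closed set is a list of all the basic sets that intersect it. -/
def NamesClosed (p : ℕ → ℕ) (C : Set Sphere) : Prop :=
  Lists p {k | (basicSet k ∩ C).Nonempty}

open Classical in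
/-- The characteristic sequence of a set of natural numbers. -/
def charSeq (X : Set ℕ) : ℕ → ℕ := fun k => if k ∈ X then 1 else 0

/-- The machine with program `c` and oracle `X` computes the function `f` with domain `A`:
from every name of every `z ∈ A` it writes a name of `f z`. -/
def ComputesFun (c : OracleCode) (X : Set ℕ) (A : Set Sphere) (f : Sphere → Sphere) : Prop :=
  ∀ z ∈ A, ∀ p, NamesPoint p z →
    ∃ s, c.Writes (join p (charSeq X)) s ∧ NamesPoint s (f z)

/-- A name of the function `f` with domain `A` consists of an oracle `X` and the code of a machine
that computes `f` from `X`; it is written as that code, followed by the characteristic sequence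
of `X`. -/
def NamesFun (q : ℕ → ℕ) (A : Set Sphere) (f : Sphere → Sphere) : Prop :=
  ∃ (c : OracleCode) (X : Set ℕ),
    q 0 = c.encode ∧ (∀ k, q (k + 1) = charSeq X k) ∧ ComputesFun c X A f

/-! ### Domains of the sphere -/

/-- A domain is an open and connected subset of the sphere. -/
def IsSphereDomain (D : Set Sphere) : Prop := IsOpen D ∧ IsConnected D

/-- The connected components of the complement of `D`. -/
def complComponents (D : Set Sphere) : Set (Set Sphere) :=
  {K | ∃ x ∈ Dᶜ, K = connectedComponentIn Dᶜ x}

/-- The boundary components of `D`: the boundaries of the components of its complement. -/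
def boundaryComponents (D : Set Sphere) : Set (Set Sphere) :=
  frontier '' complComponents D

/-- The complement of `D` has exactly `n` connected components. -/
def IsNConnected (n : ℕ) (D : Set Sphere) : Prop := (complComponents D).encard = n

/-- Each component of the complement of `D` has at least two points. -/
def IsNondegenerate (D : Set Sphere) : Prop := ∀ K ∈ complComponents D, K.Nontrivial

/-- A circular domain is a domain whose boundary components are circles. (It is used for domains
that contain `∞`, so the circles are circles of the plane.) -/
def IsCircularDomain (C : Set Sphere) : Prop :=
  IsSphereDomain C ∧ ∀ Γ ∈ boundaryComponents C, ∃ (a : ℂ) (r : ℝ), 0 < r ∧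
    Γ = (fun z : ℂ => (z : Sphere)) '' Metric.sphere a r

/-! ### Conformal maps -/

/-- A local holomorphic parametrization of the sphere that takes `0` to `p`: it is `w ↦ a + w` if
`p = a` is finite, and `w ↦ 1 / w` if `p = ∞`. -/
def param (p : Sphere) (w : ℂ) : Sphere :=
  p.elim (if w = 0 then ∞ else ((w⁻¹ : ℂ) : Sphere)) (fun a => ((a + w : ℂ) : Sphere))

/-- A local holomorphic coordinate of the sphere near `p`: it is `z` if `p` is finite (the value
at `z = ∞` is irrelevant), and `1 / z` if `p = ∞` (the value at `z = 0` is irrelevant). -/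
def coord (p z : Sphere) : ℂ :=
  p.elim (z.elim 0 fun w => w⁻¹) (fun _ => z.elim 0 fun w => w)

/-- `f` is holomorphic at `p` as a map of the sphere into itself. -/
def HolomorphicAt (f : Sphere → Sphere) (p : Sphere) : Prop :=
  ContinuousAt f p ∧ AnalyticAt ℂ (fun w : ℂ => coord (f p) (f (param p w))) 0

/-- `f` is a conformal map of `D` onto `C`. Only the values of `f` on `D` matter. -/
def IsConformalMap (f : Sphere → Sphere) (D C : Set Sphere) : Prop :=
  (∀ p ∈ D, HolomorphicAt f p) ∧ Set.BijOn f D C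

/-- `f(z) = z + O(1/z)` as `z → ∞`. -/
def IsNormalizedAtInfinity (f : Sphere → Sphere) : Prop :=
  ∃ g : ℂ → ℂ, (∀ᶠ z : ℂ in Bornology.cobounded ℂ, f (z : Sphere) = (g z : Sphere)) ∧
    (fun z => g z - z) =O[Bornology.cobounded ℂ] (fun z => z⁻¹)

/-- `C` is the circular domain `C_D` and `f`, on `D`, is the conformal map `f_D` of `D`
onto `C_D`: the one with `f_D(z) = z + O(1/z)`. -/
def IsKoebeMap (D C : Set Sphere) (f : Sphere → Sphere) : Prop :=
  IsCircularDomain C ∧ IsConformalMap f D C ∧ IsNormalizedAtInfinity f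

end SphereTTE

end

/-!
Suppose that the disc of radius `2ε` about `m` lies in `D`. By the Koebe distortion theorem, any
value `w` that the injective map `f` omits on the disc satisfies `|f m' - w| ≤ K |f m - w|` whenever
`|m' - m| ≤ ε`, with an absolute constant `K`. Hence two points `m` and `m'` of `D` whose images
violate this inequality for a boundary point `w` of `C` certify that the disc meets `∂D`, and only
finitely much information about the names enters such a certificate. Conversely, since `f` is a
homeomorphism of `D` onto `C`, it has at every boundary point of `D` a cluster value `w` in `∂C`;
nearby there are points `m` whose images are arbitrarily close to `w`, whereas the image of a fixed
`m'` is not, so that certificates exist. A machine enumerates them.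
-/

open Metric Set Filter Topology

namespace SphereTTE

section Distortion

variable {φ F : ℂ → ℂ} {c z : ℂ} {R M s : ℝ}

theorem norm_deriv_mul_dist_sub_le_dist (hR : 0 < R) (hd : DifferentiableOn ℂ φ (ball c R))
    (hmaps : MapsTo φ (ball c R) (closedBall (φ c) M)) (hz : z ∈ ball c R) :
    ‖deriv φ c‖ * dist z c - 2 * M * (dist z c / R) ^ 2 ≤ dist (φ z) (φ c) := by
  set ψ : ℂ → ℂ := fun z => φ z - deriv φ c * (z - c) with hψ
  have hφc : HasDerivAt φ (deriv φ c) c := (hd.differentiableAt (ball_mem_nhds c hR)).hasDerivAt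
  have hslope : ‖deriv φ c‖ ≤ M / R := Complex.norm_deriv_le_div_of_mapsTo_ball hd hmaps hR
  have hψmaps : MapsTo ψ (ball c R) (closedBall (ψ c) (2 * M)) := fun w hw => by
    have hlin : ‖deriv φ c * (w - c)‖ ≤ M := by
      calc ‖deriv φ c * (w - c)‖ = ‖deriv φ c‖ * dist w c := by rw [norm_mul, dist_eq_norm]
        _ ≤ M / R * R :=
            mul_le_mul hslope (mem_ball.1 hw).le dist_nonneg ((norm_nonneg _).trans hslope)
        _ = M := by field_simp
    calc dist (ψ w) (ψ c) = ‖(φ w - φ c) - deriv φ c * (w - c)‖ := by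
          rw [dist_eq_norm]; congr 1; simp only [hψ]; ring
      _ ≤ dist (φ w) (φ c) + ‖deriv φ c * (w - c)‖ := by rw [dist_eq_norm]; exact norm_sub_le _ _
      _ ≤ 2 * M := by linarith [mem_closedBall.1 (hmaps hw)]
  have hψo : (ψ · - ψ c) =o[𝓝 c] fun w => ‖w - c‖ ^ 1 := by
    simp only [pow_one]
    refine (hasDerivAt_iff_isLittleO.1 hφc).norm_right.congr_left fun w => ?_
    simp only [hψ, smul_eq_mul]
    ring
  have hψz : dist (ψ z) (ψ c) ≤ 2 * M * (dist z c / R) ^ 2 :=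
    Complex.dist_le_mul_div_pow_of_mapsTo_ball_of_isLittleO (by fun_prop) hψmaps hψo hz
  calc ‖deriv φ c‖ * dist z c - 2 * M * (dist z c / R) ^ 2
      ≤ ‖deriv φ c * (z - c)‖ - dist (ψ z) (ψ c) := by rw [norm_mul, ← dist_eq_norm]; gcongr
    _ ≤ ‖deriv φ c * (z - c) + (ψ z - ψ c)‖ := by
        rw [dist_eq_norm]; exact norm_sub_le_norm_add _ _
    _ = dist (φ z) (φ c) := by rw [dist_eq_norm]; congr 1; simp only [hψ]; ring

theorem ball_subset_image_ball_of_mapsTo_closedBall (hR : 0 < R)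
    (hd : DifferentiableOn ℂ φ (ball c R))
    (hmaps : MapsTo φ (ball c R) (closedBall (φ c) M)) :
    ball (φ c) ((‖deriv φ c‖ * R) ^ 2 / (16 * M)) ⊆ φ '' ball c R := by
  by_cases hφ' : deriv φ c = 0
  · simp [hφ']
  set d := ‖deriv φ c‖ * R with hd_def
  have hd_pos : 0 < d := by positivity
  have hdM : d ≤ M := (le_div_iff₀ hR).1 (Complex.norm_deriv_le_div_of_mapsTo_ball hd hmaps hR)
  have hM : 0 < M := hd_pos.trans_le hdM
  -- The lower bound `‖φ'(c)‖ r - 2 M (r / R) ^ 2` is largest at this radius.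
  set r := d * R / (4 * M) with hr_def
  have hr : 0 < r := by positivity
  have hrR : r < R := by
    rw [hr_def, div_lt_iff₀ (by positivity)]
    nlinarith
  have hsub : closedBall c r ⊆ ball c R := closedBall_subset_ball hrR
  have hsphere : ∀ z ∈ sphere c r, d ^ 2 / (8 * M) ≤ ‖φ z - φ c‖ := fun z hz => by
    have hlow := norm_deriv_mul_dist_sub_le_dist hR hd hmaps (hsub (sphere_subset_closedBall hz))
    rw [mem_sphere.1 hz, dist_eq_norm] at hlow
    convert hlow using 1
    rw [hr_def, show ‖deriv φ c‖ = d / R by rw [hd_def]; field_simp]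
    field_simp
    ring
  have hne : ∃ᶠ z in 𝓝 c, φ z ≠ φ c :=
    ((hd.differentiableAt (ball_mem_nhds c hR)).hasDerivAt.eventually_ne
      hφ').frequently.filter_mono nhdsWithin_le_nhds
  have hclosed : DiffContOnCl ℂ φ (ball c r) :=
    (hd.mono (by rwa [closure_ball c hr.ne'])).diffContOnCl
  have himage := hclosed.ball_subset_image_closedBall hr hsphere hne
  rw [div_div, mul_right_comm] at himage
  norm_num at himage
  exact himage.trans (image_mono hsub)

theorem ball_subset_image_ball_of_mul_ne_one (hR : 0 < R) (hd : DifferentiableOn ℂ φ (ball c R))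
    (h0 : φ c = 0) (hmul : ∀ z ∈ ball c R, ∀ w ∈ ball c R, φ z * φ w ≠ 1) (hs : 0 < s)
    (hsub : ball 0 s ⊆ φ '' ball c R) :
    ball 0 (s * ((‖deriv φ c‖ * R) ^ 2 / 16)) ⊆ φ '' ball c R := by
  have hmaps : MapsTo φ (ball c R) (closedBall (φ c) s⁻¹) := fun z hz => by
    rw [h0, mem_closedBall_zero_iff]
    by_contra! hlt
    have hφz : φ z ≠ 0 := norm_pos_iff.1 ((inv_pos.2 hs).trans hlt)
    obtain ⟨w, hw, hwz⟩ : (φ z)⁻¹ ∈ φ '' ball c R :=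
      hsub (by rw [mem_ball_zero_iff, norm_inv]; exact inv_lt_of_inv_lt₀ hs hlt)
    exact hmul z hz w hw (by rw [hwz, mul_inv_cancel₀ hφz])
  have himage := ball_subset_image_ball_of_mapsTo_closedBall hR hd hmaps
  rw [h0] at himage
  convert himage using 2
  field_simp

theorem norm_deriv_mul_le_of_mul_ne_one (hR : 0 < R) (hd : DifferentiableOn ℂ φ (ball c R))
    (h0 : φ c = 0) (hmul : ∀ z ∈ ball c R, ∀ w ∈ ball c R, φ z * φ w ≠ 1) :
    ‖deriv φ c‖ * R ≤ 4 := by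
  by_contra! hlarge
  set q := (‖deriv φ c‖ * R) ^ 2 / 16 with hq_def
  have hq : 1 < q := by rw [hq_def, lt_div_iff₀ (by norm_num)]; nlinarith
  have hφ' : deriv φ c ≠ 0 := fun h => by norm_num [h] at hlarge
  have hnhds : φ '' ball c R ∈ 𝓝 0 := by
    have hstrict := ((hd.analyticAt (ball_mem_nhds c hR)).hasStrictDerivAt).map_nhds_eq hφ'
    rw [← h0, ← hstrict]
    exact image_mem_map (ball_mem_nhds c hR)
  obtain ⟨s, hs, hsub⟩ := Metric.mem_nhds_iff.1 hnhds
  have hgrow : ∀ n : ℕ, ball 0 (s * q ^ n) ⊆ φ '' ball c R := fun n => by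
    induction n with
    | zero => simpa using hsub
    | succ n ih =>
      rw [pow_succ, ← mul_assoc]
      exact ball_subset_image_ball_of_mul_ne_one hR hd h0 hmul (by positivity) ih
  obtain ⟨n, hn⟩ := pow_unbounded_of_one_lt s⁻¹ hq
  obtain ⟨z, hz, hz1⟩ : (1 : ℂ) ∈ φ '' ball c R :=
    hgrow n (by simpa using (inv_lt_iff_one_lt_mul₀' hs).1 hn)
  exact hmul z hz z hz (by rw [hz1, one_mul])

theorem exists_eqOn_mul_exp_ball (hR : 0 < R) (hd : DifferentiableOn ℂ F (ball c R))
    (hne : ∀ z ∈ ball c R, F z ≠ 0) :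
    ∃ L : ℂ → ℂ, L c = 0 ∧ (∀ z ∈ ball c R, HasDerivAt L (logDeriv F z) z) ∧
      EqOn F (fun z => F c * Complex.exp (L z)) (ball c R) := by
  have hlog : DifferentiableOn ℂ (logDeriv F) (ball c R) := (hd.deriv isOpen_ball).div hd hne
  obtain ⟨L, hLc, hL⟩ := hlog.isExactOn_ball.with_val_at c 0
  have hexp : ∀ z ∈ ball c R, HasDerivAt (fun z => Complex.exp (L z))
      (Complex.exp (L z) * logDeriv F z) z := fun z hz => (hL z hz).cexp
  have heq : EqOn (logDeriv F) (logDeriv fun z => Complex.exp (L z)) (ball c R) := fun z hz => by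
    rw [logDeriv_apply (fun z => Complex.exp (L z)), (hexp z hz).deriv,
      mul_div_cancel_left₀ _ (Complex.exp_ne_zero _)]
  obtain ⟨a, -, ha⟩ := (logDeriv_eqOn_iff hd
    (fun z hz => (hexp z hz).differentiableAt.differentiableWithinAt) isOpen_ball
    (convex_ball c R).isPreconnected (fun z _ => Complex.exp_ne_zero _) hne).1 heq
  have hac : F c = a := by simpa [hLc] using ha (mem_ball_self hR)
  exact ⟨L, hLc, hL, by simpa [hac, Pi.smul_def] using ha⟩

theorem norm_logDeriv_mul_le_of_add_ne_zero (hR : 0 < R) (hd : DifferentiableOn ℂ F (ball c R))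
    (hadd : ∀ z ∈ ball c R, ∀ w ∈ ball c R, F z + F w ≠ 0) :
    ‖logDeriv F c‖ * R ≤ 8 := by
  have hc : c ∈ ball c R := mem_ball_self hR
  have hFc : F c ≠ 0 := fun h => hadd c hc c hc (by rw [h, add_zero])
  have hF : HasDerivAt F (deriv F c) c := (hd.differentiableAt (ball_mem_nhds c hR)).hasDerivAt
  set φ : ℂ → ℂ := fun z => (F z - F c) / (F z + F c) with hφ
  have hφd : DifferentiableOn ℂ φ (ball c R) :=
    (hd.sub_const _).div (hd.add_const _) fun z hz => hadd z hz c hc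
  have hφc : deriv φ c = logDeriv F c / 2 := by
    refine ((hF.sub_const (F c)).div (hF.add_const (F c)) (hadd c hc c hc)).deriv.trans ?_
    rw [logDeriv_apply]
    field_simp
    ring
  have hmul : ∀ z ∈ ball c R, ∀ w ∈ ball c R, φ z * φ w ≠ 1 := fun z hz w hw hzw => by
    have hzc := hadd z hz c hc
    have hwc := hadd w hw c hc
    simp only [hφ] at hzw
    field_simp at hzw
    refine hadd z hz w hw (mul_left_cancel₀ hFc ?_)
    linear_combination (-1 / 2 : ℂ) * hzw
  have hle := norm_deriv_mul_le_of_mul_ne_one hR hφd (by simp [hφ]) hmul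
  rw [hφc, norm_div, Complex.norm_ofNat] at hle
  linarith

theorem norm_logDeriv_mul_le_of_injOn (hR : 0 < R) (hd : DifferentiableOn ℂ F (ball c R))
    (hne : ∀ z ∈ ball c R, F z ≠ 0) (hinj : InjOn F (ball c R)) :
    ‖logDeriv F c‖ * R ≤ 16 := by
  obtain ⟨L, -, hL, hFL⟩ := exists_eqOn_mul_exp_ball hR hd hne
  set h : ℂ → ℂ := fun z => Complex.exp (L z / 2) with hh
  have hsq : ∀ z ∈ ball c R, F z = F c * h z ^ 2 := fun z hz => by
    rw [hFL hz, hh, sq, ← Complex.exp_add, add_halves]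
  have hderiv : ∀ z ∈ ball c R, HasDerivAt h (h z * (logDeriv F z / 2)) z := fun z hz =>
    ((hL z hz).div_const 2).cexp
  -- The square root `h` of `F / F c` inherits injectivity, and so it never takes opposite values.
  have hadd : ∀ z ∈ ball c R, ∀ w ∈ ball c R, h z + h w ≠ 0 := fun z hz w hw hzw => by
    have hzw' : h z = -h w := eq_neg_of_add_eq_zero_left hzw
    obtain rfl : z = w := hinj hz hw (by rw [hsq z hz, hsq w hw, hzw', neg_sq])
    exact Complex.exp_ne_zero _ (self_eq_neg.1 hzw')
  have hle := norm_logDeriv_mul_le_of_add_ne_zero hR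
    (fun z hz => (hderiv z hz).differentiableAt.differentiableWithinAt) hadd
  rw [logDeriv_apply, (hderiv c (mem_ball_self hR)).deriv,
    mul_div_cancel_left₀ _ (Complex.exp_ne_zero _), norm_div, Complex.norm_ofNat] at hle
  linarith

theorem norm_le_exp_mul_of_injOn (hR : 0 < R) (hd : DifferentiableOn ℂ F (ball c R))
    (hne : ∀ z ∈ ball c R, F z ≠ 0) (hinj : InjOn F (ball c R)) (hz : dist z c ≤ R / 2) :
    ‖F z‖ ≤ Real.exp 16 * ‖F c‖ := by
  obtain ⟨L, hLc, hL, hFL⟩ := exists_eqOn_mul_exp_ball hR hd hne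
  have hsub : closedBall c (R / 2) ⊆ ball c R := closedBall_subset_ball (half_lt_self hR)
  have hbound : ∀ w ∈ closedBall c (R / 2), ‖logDeriv F w‖ ≤ 32 / R := fun w hw => by
    have hball : ball w (R / 2) ⊆ ball c R :=
      ball_subset_ball' (by linarith [mem_closedBall.1 hw])
    have hw16 := norm_logDeriv_mul_le_of_injOn (half_pos hR) (hd.mono hball)
      (fun u hu => hne u (hball hu)) (hinj.mono hball)
    rw [le_div_iff₀ hR]
    linarith
  have hmean := (convex_closedBall c (R / 2)).norm_image_sub_le_of_norm_hasDerivWithin_le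
    (fun w hw => (hL w (hsub hw)).hasDerivWithinAt) hbound
    (mem_closedBall_self (half_pos hR).le) hz
  have hL16 : ‖L z‖ ≤ 16 := by
    calc ‖L z‖ ≤ 32 / R * dist z c := by simpa [hLc, dist_eq_norm] using hmean
      _ ≤ 32 / R * (R / 2) := by gcongr
      _ = 16 := by field_simp; norm_num
  calc ‖F z‖ = Real.exp (L z).re * ‖F c‖ := by
        rw [hFL (hsub hz), norm_mul, Complex.norm_exp, mul_comm]
    _ ≤ Real.exp 16 * ‖F c‖ := by gcongr; exact (Complex.re_le_norm _).trans hL16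

end Distortion

section Machines

open Nat.Partrec (Code)

namespace OracleCode

variable {O : ℕ → ℕ} {cf cg : OracleCode} {a m n v : ℕ}

theorem mem_eval_zero : v ∈ zero.eval O n ↔ v = 0 :=
  Part.mem_some_iff

theorem mem_eval_succ : v ∈ succ.eval O n ↔ v = n + 1 :=
  Part.mem_some_iff

theorem mem_eval_left : v ∈ left.eval O n ↔ v = n.unpair.1 :=
  Part.mem_some_iff

theorem mem_eval_right : v ∈ right.eval O n ↔ v = n.unpair.2 :=
  Part.mem_some_iff

theorem mem_eval_oracle : v ∈ oracle.eval O n ↔ v = O n :=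
  Part.mem_some_iff

theorem mem_eval_pair :
    v ∈ (pair cf cg).eval O n ↔ ∃ x ∈ cf.eval O n, ∃ y ∈ cg.eval O n, Nat.pair x y = v := by
  simp [eval, Seq.seq]

theorem mem_eval_comp :
    v ∈ (comp cf cg).eval O n ↔ ∃ x ∈ cg.eval O n, v ∈ cf.eval O x :=
  Part.mem_bind_iff (f := cg.eval O n) (g := cf.eval O)

theorem mem_eval_prec_zero : v ∈ (prec cf cg).eval O (Nat.pair a 0) ↔ v ∈ cf.eval O a := by
  simp [eval]

theorem mem_eval_prec_succ :
    v ∈ (prec cf cg).eval O (Nat.pair a (m + 1)) ↔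
      ∃ x ∈ (prec cf cg).eval O (Nat.pair a m), v ∈ cg.eval O (Nat.pair a (Nat.pair m x)) := by
  simp [eval]

theorem mem_eval_rfind' :
    v ∈ (rfind' cf).eval O n ↔ ∃ x, 0 ∈ cf.eval O (Nat.pair n.unpair.1 (x + n.unpair.2)) ∧
      (∀ m < x, ∃ y ∈ cf.eval O (Nat.pair n.unpair.1 (m + n.unpair.2)), y ≠ 0) ∧
      x + n.unpair.2 = v := by
  refine Part.mem_map_iff _ |>.trans <| exists_congr fun x =>
    (and_congr_left' Nat.mem_rfind).trans ?_
  simp [and_assoc, eq_comm]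

/-- A program without oracle, as a program of an oracle machine. -/
def ofCode : Code → OracleCode
  | .zero => zero
  | .succ => succ
  | .left => left
  | .right => right
  | .pair cf cg => pair (ofCode cf) (ofCode cg)
  | .comp cf cg => comp (ofCode cf) (ofCode cg)
  | .prec cf cg => prec (ofCode cf) (ofCode cg)
  | .rfind' cf => rfind' (ofCode cf)

theorem eval_ofCode (O : ℕ → ℕ) (c : Code) : (ofCode c).eval O = c.eval := by
  induction c with
  | zero | succ | left | right => rfl
  | pair cf cg hf hg | comp cf cg hf hg | prec cf cg hf hg =>
    simp only [ofCode, eval, Code.eval, hf, hg]; rfl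
  | rfind' cf hf => simp only [ofCode, eval, Code.eval, hf]; rfl

theorem exists_eval_eq_of_primrec {f : ℕ → ℕ} (hf : Primrec f) :
    ∃ c : OracleCode, ∀ O n, c.eval O n = Part.some (f n) := by
  obtain ⟨c, hc⟩ := Code.exists_code.1 (Nat.Partrec.of_primrec (Primrec.nat_iff.1 hf))
  exact ⟨ofCode c, fun O n => by rw [eval_ofCode, hc]; rfl⟩

/-- The program that reads the first `n` cells of the tape into the code of a list, the last cell
first; it takes `n` as the second component of its input. -/
def readCells : OracleCode :=
  prec zero (comp succ (pair (comp oracle (comp left right)) (comp right right)))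

theorem mem_eval_readCells (O : ℕ → ℕ) (n : ℕ) :
    Encodable.encode ((List.range n).map O).reverse ∈ readCells.eval O (Nat.pair 0 n) := by
  induction n with
  | zero => exact mem_eval_prec_zero.2 (mem_eval_zero.2 rfl)
  | succ n ih =>
    refine mem_eval_prec_succ.2 ⟨_, ih, ?_⟩
    simp [mem_eval_comp, mem_eval_pair, mem_eval_succ, mem_eval_left, mem_eval_right,
      mem_eval_oracle, List.range_succ]

theorem exists_writes_of_primrec {T : ℕ → List ℕ → ℕ} (hT : Primrec₂ T) :
    ∃ c : OracleCode, ∀ O, c.Writes O fun k => T k ((List.range k.unpair.1).map O) := by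
  let run : ℕ → ℕ := fun m =>
    T m.unpair.1 ((Encodable.decode (α := List ℕ) m.unpair.2).getD []).reverse
  have hrun : Primrec run :=
    hT.comp (Primrec.fst.comp .unpair) (Primrec.list_reverse.comp
      (Primrec.option_getD.comp (Primrec.decode.comp (Primrec.snd.comp .unpair)) (.const [])))
  obtain ⟨c, hc⟩ := exists_eval_eq_of_primrec hrun
  refine ⟨comp c (pair (pair left right) (comp readCells (pair zero left))), fun O k => ?_⟩
  have hk : k ∈ (pair left right).eval O k := by
    simp [mem_eval_pair, mem_eval_left, mem_eval_right]
  have hcells : Encodable.encode ((List.range k.unpair.1).map O).reverse ∈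
      (comp readCells (pair zero left)).eval O k :=
    mem_eval_comp.2 ⟨Nat.pair 0 k.unpair.1,
      by simp [mem_eval_pair, mem_eval_zero, mem_eval_left], mem_eval_readCells O _⟩
  refine Part.eq_some_iff.2 (mem_eval_comp.2 ⟨_, mem_eval_pair.2 ⟨_, hk, _, hcells, rfl⟩, ?_⟩)
  rw [hc, Part.mem_some_iff]
  simp [run]

/-- The inverse of `encode`. -/
def ofNat : ℕ → OracleCode
  | 0 => zero
  | 1 => succ
  | 2 => left
  | 3 => right
  | 4 => oracle
  | n + 5 =>
    have : (n / 4).unpair.1 < n + 5 := (Nat.unpair_left_le _).trans_lt (by omega)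
    have : (n / 4).unpair.2 < n + 5 := (Nat.unpair_right_le _).trans_lt (by omega)
    match n % 4 with
    | 0 => pair (ofNat (n / 4).unpair.1) (ofNat (n / 4).unpair.2)
    | 1 => prec (ofNat (n / 4).unpair.1) (ofNat (n / 4).unpair.2)
    | 2 => comp (ofNat (n / 4).unpair.1) (ofNat (n / 4).unpair.2)
    | _ => rfind' (ofNat (n / 4))

theorem ofNat_encode (c : OracleCode) : ofNat c.encode = c := by
  induction c with
  | zero | succ | left | right | oracle => simp only [encode, ofNat]
  | pair cf cg hf hg =>
    rw [encode, ofNat]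
    have hmod : 2 * (2 * Nat.pair cf.encode cg.encode) % 4 = 0 := by omega
    have hdiv : 2 * (2 * Nat.pair cf.encode cg.encode) / 4 = Nat.pair cf.encode cg.encode := by
      omega
    simp only [hmod, hdiv, Nat.unpair_pair, hf, hg]
  | comp cf cg hf hg =>
    rw [encode, ofNat]
    have hmod : 2 * (2 * Nat.pair cf.encode cg.encode + 1) % 4 = 2 := by omega
    have hdiv : 2 * (2 * Nat.pair cf.encode cg.encode + 1) / 4 =
      Nat.pair cf.encode cg.encode := by omega
    simp only [hmod, hdiv, Nat.unpair_pair, hf, hg]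
  | prec cf cg hf hg =>
    rw [encode, ofNat]
    have hmod : (2 * (2 * Nat.pair cf.encode cg.encode) + 1) % 4 = 1 := by omega
    have hdiv : (2 * (2 * Nat.pair cf.encode cg.encode) + 1) / 4 =
      Nat.pair cf.encode cg.encode := by omega
    simp only [hmod, hdiv, Nat.unpair_pair, hf, hg]
  | rfind' cf hf =>
    rw [encode, ofNat]
    have hmod : (2 * (2 * cf.encode + 1) + 1) % 4 = 3 := by omega
    have hdiv : (2 * (2 * cf.encode + 1) + 1) / 4 = cf.encode := by omega
    simp only [hmod, hdiv, hf]

/-- The program obtained by replacing oracle queries by calls of the program `o`. -/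
def subst (o : Code) : OracleCode → Code
  | zero => .zero
  | succ => .succ
  | left => .left
  | right => .right
  | oracle => o
  | pair cf cg => .pair (subst o cf) (subst o cg)
  | comp cf cg => .comp (subst o cf) (subst o cg)
  | prec cf cg => .prec (subst o cf) (subst o cg)
  | rfind' cf => .rfind' (subst o cf)

/-- The course-of-values recursion for `fun e => subst o (ofNat e)`: its value at `l.length` in
terms of the list `l` of its values at the smaller numbers. -/
def substStep (o : Code) (l : List Code) : Code :=
  if l.length < 5 then [.zero, .succ, .left, .right, o].getD l.length .zero
  else
    let sub : ℕ → Code := fun i => l.getD i .zero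
    let e := (l.length - 5) / 4
    [.pair (sub e.unpair.1) (sub e.unpair.2), .prec (sub e.unpair.1) (sub e.unpair.2),
      .comp (sub e.unpair.1) (sub e.unpair.2), .rfind' (sub e)].getD ((l.length - 5) % 4) .zero

theorem primrec₂_substStep : Primrec₂ substStep := by
  have hlen : Primrec fun p : Code × List Code => p.2.length := Primrec.list_length.comp .snd
  have hsub5 := Primrec.nat_sub.comp hlen (.const 5)
  have he := Primrec.nat_div.comp hsub5 (.const 4)
  have hget {i : Code × List Code → ℕ} (hi : Primrec i) :
      Primrec fun p : Code × List Code => p.2.getD (i p) Code.zero :=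
    (Primrec.list_getD Code.zero).comp .snd hi
  have hleft := hget (Primrec.fst.comp (Primrec.unpair.comp he))
  have hright := hget (Primrec.snd.comp (Primrec.unpair.comp he))
  refine .ite (Primrec.nat_lt.comp hlen (.const 5))
    ((Primrec.list_getD _).comp ?_ hlen)
    ((Primrec.list_getD _).comp ?_ (Primrec.nat_mod.comp hsub5 (.const 4)))
  · exact Primrec.list_cons.comp (.const _) <| Primrec.list_cons.comp (.const _) <|
      Primrec.list_cons.comp (.const _) <| Primrec.list_cons.comp (.const _) <|
      Primrec.list_cons.comp .fst (.const [])
  · exact Primrec.list_cons.comp (Code.primrec₂_pair.comp hleft hright) <|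
      Primrec.list_cons.comp (Code.primrec₂_prec.comp hleft hright) <|
      Primrec.list_cons.comp (Code.primrec₂_comp.comp hleft hright) <|
      Primrec.list_cons.comp (Code.primrec_rfind'.comp (hget he)) (.const [])

theorem primrec₂_subst_ofNat : Primrec₂ fun (o : Code) (e : ℕ) => subst o (ofNat e) := by
  refine Primrec.nat_strong_rec _ (Primrec.option_some.comp₂ primrec₂_substStep) fun o n =>
    congrArg some ?_
  have hget : ∀ i < n, ((List.range n).map fun e => subst o (ofNat e)).getD i .zero =
      subst o (ofNat i) := fun i hi => by simp [hi]
  match n with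
  | 0 | 1 | 2 | 3 | 4 => simp [substStep, ofNat, subst]
  | n + 5 =>
    have hl : (n / 4).unpair.1 < n + 5 := (Nat.unpair_left_le _).trans_lt (by omega)
    have hr : (n / 4).unpair.2 < n + 5 := (Nat.unpair_right_le _).trans_lt (by omega)
    have h4 : n % 4 < 4 := Nat.mod_lt _ (by norm_num)
    simp only [substStep, List.length_map, List.length_range, Nat.add_sub_cancel, hget _ hl,
      hget _ hr, hget (n / 4) (by omega), ofNat, show ¬ n + 5 < 5 by omega, if_false]
    interval_cases n % 4 <;> rfl

theorem mem_eval_of_mem_eval_subst {o : Code} (ho : ∀ n, ∀ v ∈ o.eval n, v = O n)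
    (c : OracleCode) : ∀ n, ∀ v ∈ (ofCode (subst o c)).eval O n, v ∈ c.eval O n := by
  induction c with
  | zero | succ | left | right => exact fun n v h => h
  | oracle => exact fun n v h => mem_eval_oracle.2 (ho n v (by rwa [eval_ofCode] at h))
  | pair cf cg hf hg =>
    intro n v h
    obtain ⟨x, hx, y, hy, rfl⟩ := mem_eval_pair.1 h
    exact mem_eval_pair.2 ⟨x, hf _ _ hx, y, hg _ _ hy, rfl⟩
  | comp cf cg hf hg =>
    intro n v h
    obtain ⟨x, hx, hv⟩ := mem_eval_comp.1 h
    exact mem_eval_comp.2 ⟨x, hg _ _ hx, hf _ _ hv⟩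
  | prec cf cg hf hg =>
    intro n
    rw [← Nat.pair_unpair n]
    induction n.unpair.2 with
    | zero => exact fun v h => mem_eval_prec_zero.2 (hf _ _ (mem_eval_prec_zero.1 h))
    | succ m ih =>
      intro v h
      obtain ⟨x, hx, hv⟩ := mem_eval_prec_succ.1 h
      exact mem_eval_prec_succ.2 ⟨x, ih _ hx, hg _ _ hv⟩
  | rfind' cf hf =>
    intro n v h
    obtain ⟨x, hx, hlt, rfl⟩ := mem_eval_rfind'.1 h
    refine mem_eval_rfind'.2 ⟨x, hf _ _ hx, fun m hm => ?_, rfl⟩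
    obtain ⟨y, hy, hy0⟩ := hlt m hm
    exact ⟨y, hf _ _ hy, hy0⟩

/-- A halting computation makes only finitely many queries. -/
theorem eventually_mem_eval_subst {o : ℕ → Code} (ho : ∀ n, ∀ᶠ N in atTop, O n ∈ (o N).eval n)
    (c : OracleCode) :
    ∀ n, ∀ v ∈ c.eval O n, ∀ᶠ N in atTop, v ∈ (ofCode (subst (o N) c)).eval O n := by
  induction c with
  | zero | succ | left | right => exact fun n v h => .of_forall fun _ => h
  | oracle =>
    intro n v h
    obtain rfl := mem_eval_oracle.1 h
    exact (ho n).mono fun N hN => by rwa [eval_ofCode]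
  | pair cf cg hf hg =>
    intro n v h
    obtain ⟨x, hx, y, hy, rfl⟩ := mem_eval_pair.1 h
    filter_upwards [hf _ _ hx, hg _ _ hy] with N hNx hNy
    exact mem_eval_pair.2 ⟨x, hNx, y, hNy, rfl⟩
  | comp cf cg hf hg =>
    intro n v h
    obtain ⟨x, hx, hv⟩ := mem_eval_comp.1 h
    filter_upwards [hg _ _ hx, hf _ _ hv] with N hNx hNv
    exact mem_eval_comp.2 ⟨x, hNx, hNv⟩
  | prec cf cg hf hg =>
    intro n
    rw [← Nat.pair_unpair n]
    induction n.unpair.2 with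
    | zero =>
      exact fun v h => (hf _ _ (mem_eval_prec_zero.1 h)).mono fun N hN => mem_eval_prec_zero.2 hN
    | succ m ih =>
      intro v h
      obtain ⟨x, hx, hv⟩ := mem_eval_prec_succ.1 h
      filter_upwards [ih _ hx, hg _ _ hv] with N hNx hNv
      exact mem_eval_prec_succ.2 ⟨x, hNx, hNv⟩
  | rfind' cf hf =>
    intro n v h
    obtain ⟨x, hx, hlt, rfl⟩ := mem_eval_rfind'.1 h
    have hlt' : ∀ m ∈ Iio x, ∀ᶠ N in atTop, ∃ y ∈ (ofCode (subst (o N) cf)).eval O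
        (Nat.pair n.unpair.1 (m + n.unpair.2)), y ≠ 0 := fun m hm => by
      obtain ⟨y, hy, hy0⟩ := hlt m hm
      exact (hf _ _ hy).mono fun N hN => ⟨y, hN, hy0⟩
    filter_upwards [hf _ _ hx, (eventually_all_finite (finite_Iio x)).2 hlt'] with N hNx hNlt
    exact mem_eval_rfind'.2 ⟨x, hNx, hNlt, rfl⟩

theorem mem_eval_iff_exists_evaln_subst {o : ℕ → Code} (hsound : ∀ N n, ∀ v ∈ (o N).eval n, v = O n)
    (hcomplete : ∀ n, ∀ᶠ N in atTop, O n ∈ (o N).eval n) {c : OracleCode} :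
    v ∈ c.eval O n ↔ ∃ t N, v ∈ Code.evaln t (subst (o N) c) n := by
  constructor
  · intro h
    obtain ⟨N, hN⟩ := (eventually_mem_eval_subst hcomplete c n v h).exists
    rw [eval_ofCode] at hN
    obtain ⟨t, ht⟩ := Code.evaln_complete.1 hN
    exact ⟨t, N, ht⟩
  · rintro ⟨t, N, h⟩
    refine mem_eval_of_mem_eval_subst (hsound N) c n v ?_
    rw [eval_ofCode]
    exact Code.evaln_sound h

end OracleCode

end Machines

section Semidecidability

open Nat.Partrec (Code)

/-- The relations between a sequence and an element of `α` that are semidecidable relative to the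
sequence: a primitive recursive test accepts some initial segment of it. -/
def Semidecidable {α : Type*} [Primcodable α] (R : (ℕ → ℕ) → α → Prop) : Prop :=
  ∃ T : List ℕ → α → Prop, PrimrecRel T ∧ ∀ O a, R O a ↔ ∃ N, T ((List.range N).map O) a

namespace Semidecidable

variable {α β : Type*} [Primcodable α] {R S : (ℕ → ℕ) → α → Prop}

theorem take_map_range (O : ℕ → ℕ) {M N : ℕ} (h : M ≤ N) :
    ((List.range N).map O).take M = (List.range M).map O := by
  rw [← List.map_take, List.take_range, min_eq_left h]

theorem of_primrecPred {P : α → Prop} (hP : PrimrecPred P) : Semidecidable fun _ a => P a :=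
  ⟨fun _ a => P a, hP.comp .snd, fun _ _ => exists_const ℕ |>.symm⟩

theorem comp [Primcodable β] (hR : Semidecidable R) {g : β → α} (hg : Primrec g) :
    Semidecidable fun O b => R O (g b) := by
  obtain ⟨T, hT, hTR⟩ := hR
  exact ⟨fun l b => T l (g b), hT.comp .fst (hg.comp .snd), fun O b => hTR O (g b)⟩

theorem and (hR : Semidecidable R) (hS : Semidecidable S) :
    Semidecidable fun O a => R O a ∧ S O a := by
  obtain ⟨T, hT, hTR⟩ := hR
  obtain ⟨U, hU, hUS⟩ := hS
  refine ⟨fun l a => T (l.take l.length.unpair.1) a ∧ U (l.take l.length.unpair.2) a, ?_,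
    fun O a => ?_⟩
  · have hunpair : Primrec fun x : List ℕ × α => x.1.length.unpair :=
      Primrec.unpair.comp (Primrec.list_length.comp .fst)
    exact (hT.comp (Primrec.list_take.comp (Primrec.fst.comp hunpair) .fst) .snd).and
      (hU.comp (Primrec.list_take.comp (Primrec.snd.comp hunpair) .fst) .snd)
  · simp only [hTR, hUS, List.length_map, List.length_range,
      take_map_range O (Nat.unpair_left_le _), take_map_range O (Nat.unpair_right_le _)]
    constructor
    · rintro ⟨⟨M, hM⟩, N, hN⟩
      exact ⟨Nat.pair M N, by simpa using ⟨hM, hN⟩⟩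
    · rintro ⟨N, hT, hU⟩
      exact ⟨⟨_, hT⟩, _, hU⟩

theorem proj [Denumerable β] {R : (ℕ → ℕ) → α × β → Prop} (hR : Semidecidable R) :
    Semidecidable fun O a => ∃ b, R O (a, b) := by
  obtain ⟨T, hT, hTR⟩ := hR
  refine ⟨fun l a => T (l.take l.length.unpair.2) (a, Denumerable.ofNat β l.length.unpair.1), ?_,
    fun O a => ?_⟩
  · have hunpair : Primrec fun x : List ℕ × α => x.1.length.unpair :=
      Primrec.unpair.comp (Primrec.list_length.comp .fst)
    exact hT.comp (Primrec.list_take.comp (Primrec.snd.comp hunpair) .fst)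
      (Primrec.snd.pair ((Primrec.ofNat β).comp (Primrec.fst.comp hunpair)))
  · simp only [List.length_map, List.length_range, take_map_range O (Nat.unpair_right_le _)]
    constructor
    · rintro ⟨b, hb⟩
      obtain ⟨N, hN⟩ := (hTR O (a, b)).1 hb
      exact ⟨Nat.pair (Encodable.encode b) N, by simpa using hN⟩
    · rintro ⟨N, hN⟩
      exact ⟨_, (hTR O (a, _)).2 ⟨_, hN⟩⟩

theorem getElem?_map_range (O : ℕ → ℕ) (N k v : ℕ) :
    ((List.range N).map O)[k]? = some v ↔ k < N ∧ O k = v := by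
  simp [List.getElem?_eq_some_iff]

theorem apply_eq {g v : α → ℕ} (hg : Primrec g) (hv : Primrec v) :
    Semidecidable fun O a => O (g a) = v a := by
  refine ⟨fun l a => l[g a]? = some (v a), ?_, fun O a => ?_⟩
  · exact Primrec.eq.comp (Primrec.list_getElem?.comp .fst (hg.comp .snd))
      (Primrec.option_some.comp (hv.comp .snd))
  · simp only [getElem?_map_range, exists_and_right, exists_gt, true_and]

theorem exists_code_eval_curry {answer : α → ℕ → Option ℕ} (h : Primrec₂ answer) :
    ∃ o : Code, ∀ a k, (o.curry (Encodable.encode a)).eval k = answer a k := by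
  let run : ℕ → Option ℕ := fun m =>
    (Encodable.decode (α := α) m.unpair.1).bind fun a => answer a m.unpair.2
  have hrun : Primrec run :=
    Primrec.option_bind (Primrec.decode.comp (Primrec.fst.comp .unpair))
      (h.comp .snd (Primrec.snd.comp (Primrec.unpair.comp .fst)))
  obtain ⟨o, ho⟩ := Code.exists_code.1 (Partrec.nat_iff.1 (Computable.ofOption hrun.to_comp))
  exact ⟨o, fun a k => by simp [Code.eval_curry, ho, run]⟩

/-- A machine whose tape is interleaved from a computable sequence and from cells of `O` is
simulated on ever longer initial segments of `O`. -/
theorem mem_eval {e n v : α → ℕ} {s : α → ℕ → ℕ} {g : ℕ → ℕ} (he : Primrec e) (hn : Primrec n)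
    (hv : Primrec v) (hs : Primrec₂ s) (hg : Primrec g) :
    Semidecidable fun O a =>
      v a ∈ (OracleCode.ofNat (e a)).eval (join (s a) fun k => O (g k)) (n a) := by
  let answer : List ℕ × α → ℕ → Option ℕ := fun x k =>
    if k % 2 = 0 then some (s x.2 (k / 2)) else x.1[g (k / 2)]?
  have hanswer : Primrec₂ answer := by
    have hhalf : Primrec fun x : (List ℕ × α) × ℕ => x.2 / 2 := Primrec.nat_div.comp .snd (.const 2)
    exact .ite (Primrec.eq.comp (Primrec.nat_mod.comp .snd (.const 2)) (.const 0))
      (Primrec.option_some.comp (hs.comp (Primrec.snd.comp .fst) hhalf))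
      (Primrec.list_getElem?.comp (Primrec.fst.comp .fst) (hg.comp hhalf))
  obtain ⟨o, ho⟩ := exists_code_eval_curry hanswer
  let simulation : List ℕ → α → Code := fun l a =>
    OracleCode.subst (o.curry (Encodable.encode (l, a))) (OracleCode.ofNat (e a))
  have hsimulation : Primrec₂ simulation :=
    OracleCode.primrec₂_subst_ofNat.comp
      (Code.primrec₂_curry.comp (.const o) (Primrec.encode.comp .id)) (he.comp .snd)
  have hsteps : Semidecidable fun O (x : α × ℕ) =>
      ∃ N, Code.evaln x.2 (simulation ((List.range N).map O) x.1) (n x.1) = some (v x.1) :=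
    ⟨fun l x => Code.evaln x.2 (simulation l x.1) (n x.1) = some (v x.1),
      Primrec.eq.comp
        (Code.primrec_evaln.comp
          (((Primrec.snd.comp .snd).pair (hsimulation.comp .fst (Primrec.fst.comp .snd))).pair
            (hn.comp (Primrec.fst.comp .snd))))
        (Primrec.option_some.comp (hv.comp (Primrec.fst.comp .snd))), fun _ _ => Iff.rfl⟩
  convert hsteps.proj using 3 with O a
  refine OracleCode.mem_eval_iff_exists_evaln_subst
    (o := fun N => o.curry (Encodable.encode ((List.range N).map O, a)))
    (fun N k w hw => ?_) fun k => ?_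
  · rw [ho] at hw
    by_cases hk : k % 2 = 0
    · simpa [answer, join, hk] using hw
    · have hw : ((List.range N).map O)[g (k / 2)]? = some w := by simpa [answer, hk] using hw
      simpa [join, hk] using ((getElem?_map_range O N _ w).1 hw).2.symm
  · filter_upwards [eventually_gt_atTop (g (k / 2))] with N hN
    rw [ho]
    by_cases hk : k % 2 = 0
    · simp [answer, join, hk]
    · simp [answer, join, hk, hN]

theorem exists_writes {R : (ℕ → ℕ) → ℕ → Prop} (hR : Semidecidable R) :
    ∃ c : OracleCode, ∀ O, ∃ s, c.Writes O s ∧ Lists s {j | R O j} := by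
  classical
  obtain ⟨T, hT, hTR⟩ := hR
  obtain ⟨c, hc⟩ := OracleCode.exists_writes_of_primrec
    (T := fun k l => if T l k.unpair.2 then k.unpair.2 + 1 else 0) <| by
    have hj : Primrec fun x : ℕ × List ℕ => x.1.unpair.2 :=
      Primrec.snd.comp (Primrec.unpair.comp .fst)
    exact .ite (hT.comp .snd hj) (Primrec.succ.comp hj) (.const 0)
  refine ⟨c, fun O => ⟨_, hc O, fun j => (hTR O j).trans ⟨?_, ?_⟩⟩⟩
  · rintro ⟨N, hN⟩
    exact ⟨Nat.pair N j, by simp [hN]⟩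
  · rintro ⟨k, hk⟩
    by_cases hTk : T ((List.range k.unpair.1).map O) k.unpair.2
    · simp only [hTk, if_true, Nat.add_right_cancel_iff] at hk
      exact ⟨_, hk ▸ hTk⟩
    · simp [hTk] at hk

end Semidecidable

end Semidecidability

section RationalArithmetic

theorem ratOf_surjective : Function.Surjective ratOf := fun q => by
  have hnum : (q.num.toNat : ℚ) - (-q.num).toNat = q.num := by
    exact_mod_cast (by omega : (q.num.toNat : ℤ) - (-q.num).toNat = q.num)
  have hden : ((q.den - 1 : ℕ) : ℚ) + 1 = q.den := by
    exact_mod_cast Nat.sub_add_cancel q.den_pos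
  refine ⟨Nat.pair (Nat.pair q.num.toNat (-q.num).toNat) (q.den - 1), ?_⟩
  simp only [ratOf, Nat.unpair_pair, hnum, hden, Rat.num_div_den]

theorem posRatOf_pos (k : ℕ) : 0 < posRatOf k := by
  rw [posRatOf]
  positivity

theorem exists_posRatOf_eq {q : ℚ} (hq : 0 < q) : ∃ k, posRatOf k = q := by
  have hnum : ((q.num.toNat - 1 : ℕ) : ℚ) + 1 = q.num := by
    have := Rat.num_pos.2 hq
    exact_mod_cast (by omega : ((q.num.toNat - 1 : ℕ) : ℤ) + 1 = q.num)
  have hden : ((q.den - 1 : ℕ) : ℚ) + 1 = q.den := by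
    exact_mod_cast Nat.sub_add_cancel q.den_pos
  refine ⟨Nat.pair (q.num.toNat - 1) (q.den - 1), ?_⟩
  simp only [posRatOf, Nat.unpair_pair, hnum, hden, Rat.num_div_den]

variable {α : Type*} [Primcodable α]

/-- A real valued function with rational values for which the terms of a representation
`(a - b) / (c + 1)` of the values are primitive recursive. -/
def RatPrimrec (q : α → ℝ) : Prop :=
  ∃ a b c : α → ℕ, Primrec a ∧ Primrec b ∧ Primrec c ∧
    ∀ x, q x = ((a x : ℝ) - b x) / (c x + 1)

namespace RatPrimrec

variable {q q' : α → ℝ} {g : α → ℕ}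

theorem ratOf (hg : Primrec g) : RatPrimrec fun x => (ratOf (g x) : ℝ) :=
  have hu := Primrec.unpair.comp hg
  have hu' := Primrec.unpair.comp (Primrec.fst.comp hu)
  ⟨_, _, _, Primrec.fst.comp hu', Primrec.snd.comp hu', Primrec.snd.comp hu,
    fun x => by simp [SphereTTE.ratOf]⟩

theorem posRatOf (hg : Primrec g) : RatPrimrec fun x => (posRatOf (g x) : ℝ) :=
  have hu := Primrec.unpair.comp hg
  ⟨_, _, _, Primrec.succ.comp (Primrec.fst.comp hu), .const 0, Primrec.snd.comp hu,
    fun x => by simp [SphereTTE.posRatOf]⟩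

theorem natCast (n : ℕ) : RatPrimrec fun _ : α => (n : ℝ) :=
  ⟨_, _, _, .const n, .const 0, .const 0, fun _ => by simp⟩

theorem neg (h : RatPrimrec q) : RatPrimrec fun x => -q x := by
  obtain ⟨a, b, c, ha, hb, hc, hq⟩ := h
  exact ⟨b, a, c, hb, ha, hc, fun x => by simp only [hq, ← neg_div, neg_sub]⟩

theorem add (h : RatPrimrec q) (h' : RatPrimrec q') : RatPrimrec fun x => q x + q' x := by
  obtain ⟨a, b, c, ha, hb, hc, hq⟩ := h
  obtain ⟨a', b', c', ha', hb', hc', hq'⟩ := h'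
  refine ⟨fun x => a x * (c' x + 1) + a' x * (c x + 1),
    fun x => b x * (c' x + 1) + b' x * (c x + 1), fun x => c x * (c' x + 1) + c' x,
    ?_, ?_, ?_, fun x => ?_⟩
  · exact Primrec.nat_add.comp (Primrec.nat_mul.comp ha (Primrec.succ.comp hc'))
      (Primrec.nat_mul.comp ha' (Primrec.succ.comp hc))
  · exact Primrec.nat_add.comp (Primrec.nat_mul.comp hb (Primrec.succ.comp hc'))
      (Primrec.nat_mul.comp hb' (Primrec.succ.comp hc))
  · exact Primrec.nat_add.comp (Primrec.nat_mul.comp hc (Primrec.succ.comp hc')) hc'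
  · simp only [hq, hq']
    rw [div_add_div _ _ (by positivity) (by positivity)]
    push_cast
    congr 1 <;> ring

theorem sub (h : RatPrimrec q) (h' : RatPrimrec q') : RatPrimrec fun x => q x - q' x := by
  simpa only [sub_eq_add_neg] using h.add h'.neg

theorem mul (h : RatPrimrec q) (h' : RatPrimrec q') : RatPrimrec fun x => q x * q' x := by
  obtain ⟨a, b, c, ha, hb, hc, hq⟩ := h
  obtain ⟨a', b', c', ha', hb', hc', hq'⟩ := h'
  refine ⟨fun x => a x * a' x + b x * b' x, fun x => a x * b' x + b x * a' x,
    fun x => c x * (c' x + 1) + c' x, ?_, ?_, ?_, fun x => ?_⟩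
  · exact Primrec.nat_add.comp (Primrec.nat_mul.comp ha ha') (Primrec.nat_mul.comp hb hb')
  · exact Primrec.nat_add.comp (Primrec.nat_mul.comp ha hb') (Primrec.nat_mul.comp hb ha')
  · exact Primrec.nat_add.comp (Primrec.nat_mul.comp hc (Primrec.succ.comp hc')) hc'
  · simp only [hq, hq']
    rw [div_mul_div_comm]
    push_cast
    congr 1 <;> ring

theorem sq (h : RatPrimrec q) : RatPrimrec fun x => q x ^ 2 := by
  simpa only [_root_.sq] using h.mul h

theorem lt (h : RatPrimrec q) (h' : RatPrimrec q') : PrimrecPred fun x => q x < q' x := by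
  obtain ⟨a, b, c, ha, hb, hc, hq⟩ := h
  obtain ⟨a', b', c', ha', hb', hc', hq'⟩ := h'
  refine (Primrec.nat_lt.comp
    (Primrec.nat_add.comp (Primrec.nat_mul.comp ha (Primrec.succ.comp hc'))
      (Primrec.nat_mul.comp hb' (Primrec.succ.comp hc)))
    (Primrec.nat_add.comp (Primrec.nat_mul.comp ha' (Primrec.succ.comp hc))
      (Primrec.nat_mul.comp hb (Primrec.succ.comp hc')))).of_eq fun x => ?_
  rw [hq, hq', div_lt_div_iff₀ (by positivity) (by positivity), ← Nat.cast_lt (α := ℝ)]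
  push_cast
  constructor <;> intro h <;> linarith

end RatPrimrec

end RationalArithmetic

section BasicSets

/-- The point with rational coordinates and code `m`. -/
def pointOf (m : ℕ) : ℂ := ⟨ratOf m.unpair.1, ratOf m.unpair.2⟩

theorem denseRange_pointOf : DenseRange pointOf := by
  have hcast : DenseRange fun k => (ratOf k : ℝ) := by
    have := Rat.denseRange_cast (𝕜 := ℝ)
    rwa [DenseRange, ← ratOf_surjective.range_comp] at this
  have hpair := Complex.equivRealProdCLM.symm.surjective.denseRange.comp
    (hcast.prodMap hcast) Complex.equivRealProdCLM.symm.continuous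
  rwa [DenseRange, ← Nat.pairEquiv.symm.surjective.range_comp] at hpair

/-- The lower left corner of the rectangle with code `k`. -/
def corner (k : ℕ) : ℂ := pointOf (k / 2).unpair.1

/-- The width of the rectangle with code `k`. -/
def width (k : ℕ) : ℝ := posRatOf (k / 2).unpair.2.unpair.1

/-- The height of the rectangle with code `k`. -/
def height (k : ℕ) : ℝ := posRatOf (k / 2).unpair.2.unpair.2

theorem coe_mem_basicSet_of_even {k : ℕ} (hk : k % 2 = 0) {z : ℂ} :
    (z : Sphere) ∈ basicSet k ↔ (corner k).re < z.re ∧ z.re < (corner k).re + width k ∧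
      (corner k).im < z.im ∧ z.im < (corner k).im + height k := by
  simp [basicSet, hk, rectangle, corner, pointOf, width, height]

theorem isOpen_basicSet (k : ℕ) : IsOpen (basicSet k) := by
  rw [basicSet]
  split_ifs
  · rw [rectangle, OnePoint.isOpen_image_coe]
    exact (isOpen_lt continuous_const Complex.continuous_re).inter
      ((isOpen_lt Complex.continuous_re continuous_const).inter
        ((isOpen_lt continuous_const Complex.continuous_im).inter
          (isOpen_lt Complex.continuous_im continuous_const)))
  · rw [diskExterior, OnePoint.isOpen_compl_image_coe]
    exact ⟨isClosed_closedBall, isCompact_closedBall _ _⟩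

theorem exists_mem_basicSet_width_add_height_lt (ω : ℂ) {η : ℝ} (hη : 0 < η) :
    ∃ j, j % 2 = 0 ∧ (ω : Sphere) ∈ basicSet j ∧ width j + height j < η := by
  obtain ⟨w, hw0, hw⟩ := exists_rat_btwn (half_pos hη)
  rw [Rat.cast_pos] at hw0
  obtain ⟨c, hc⟩ := exists_posRatOf_eq hw0
  obtain ⟨m, hm⟩ := denseRange_pointOf.exists_mem_open
    (s := {z : ℂ | (ω.re - w < z.re ∧ z.re < ω.re) ∧ ω.im - w < z.im ∧ z.im < ω.im})
    (((isOpen_lt continuous_const Complex.continuous_re).inter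
      (isOpen_lt Complex.continuous_re continuous_const)).inter
      ((isOpen_lt continuous_const Complex.continuous_im).inter
        (isOpen_lt Complex.continuous_im continuous_const)))
    ⟨⟨ω.re - w / 2, ω.im - w / 2⟩, by simp [hw0]⟩
  obtain ⟨⟨hx, hx'⟩, hy, hy'⟩ := hm
  have hj : 2 * Nat.pair m (Nat.pair c c) % 2 = 0 := by omega
  refine ⟨2 * Nat.pair m (Nat.pair c c), hj, ?_, ?_⟩
  · simp only [coe_mem_basicSet_of_even hj, corner, width, height,
      Nat.mul_div_cancel_left _ zero_lt_two, Nat.unpair_pair, hc]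
    exact ⟨by linarith, by linarith, by linarith, by linarith⟩
  · simp only [width, height, Nat.mul_div_cancel_left _ zero_lt_two, Nat.unpair_pair, hc]
    linarith

theorem image_closedBall_subset_basicSet_of_even {k : ℕ} (hk : k % 2 = 0) {c : ℂ} {r : ℝ}
    (hr : 0 ≤ r) :
    (↑) '' closedBall c r ⊆ basicSet k ↔
      (corner k).re < c.re - r ∧ c.re + r < (corner k).re + width k ∧
      (corner k).im < c.im - r ∧ c.im + r < (corner k).im + height k := by
  simp only [image_subset_iff]
  constructor
  · intro h
    have hmem (x y : ℝ) (hxy : |x| + |y| ≤ r) := (coe_mem_basicSet_of_even hk).1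
      (h (show c + ⟨x, y⟩ ∈ closedBall c r by
        simpa using (Complex.norm_le_abs_re_add_abs_im ⟨x, y⟩).trans hxy))
    have hr' : |r| = r := abs_of_nonneg hr
    exact ⟨(hmem (-r) 0 (by simp [hr'])).1, (hmem r 0 (by simp [hr'])).2.1,
      (hmem 0 (-r) (by simp [hr'])).2.2.1, (hmem 0 r (by simp [hr'])).2.2.2⟩
  · rintro ⟨h1, h2, h3, h4⟩ z hz
    rw [mem_closedBall_iff_norm] at hz
    have hre := abs_le.1 ((Complex.abs_re_le_norm _).trans hz)
    have him := abs_le.1 ((Complex.abs_im_le_norm _).trans hz)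
    rw [Complex.sub_re] at hre
    rw [Complex.sub_im] at him
    exact (coe_mem_basicSet_of_even hk).2 ⟨by linarith, by linarith, by linarith, by linarith⟩

theorem image_closedBall_subset_basicSet_of_odd {k : ℕ} (hk : ¬k % 2 = 0) {c : ℂ} {r : ℝ}
    (hr : 0 ≤ r) : (↑) '' closedBall c r ⊆ basicSet k ↔ r + posRatOf (k / 2) < ‖c‖ := by
  have hpos : (0 : ℝ) ≤ posRatOf (k / 2) := by exact_mod_cast (posRatOf_pos _).le
  rw [← dist_zero_right, ← disjoint_closedBall_closedBall_iff hr hpos, basicSet, if_neg hk,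
    diskExterior, subset_compl_iff_disjoint_right, disjoint_image_iff OnePoint.coe_injective]

/-- Two rectangles whose distance exceeds `K` times the size of the first. Distances are measured
from the lower left corners. -/
def Separated (K j j' : ℕ) : Prop :=
  j % 2 = 0 ∧ j' % 2 = 0 ∧
    (2 * K + 1) * (width j + height j) + (width j' + height j') < ‖corner j - corner j'‖

theorem width_pos (k : ℕ) : 0 < width k := Rat.cast_pos.2 (posRatOf_pos _)

theorem height_pos (k : ℕ) : 0 < height k := Rat.cast_pos.2 (posRatOf_pos _)

theorem norm_sub_corner_lt {k : ℕ} (hk : k % 2 = 0) {z : ℂ} (hz : (z : Sphere) ∈ basicSet k) :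
    ‖z - corner k‖ < width k + height k := by
  obtain ⟨h1, h2, h3, h4⟩ := (coe_mem_basicSet_of_even hk).1 hz
  refine (Complex.norm_le_abs_re_add_abs_im _).trans_lt ?_
  rw [Complex.sub_re, Complex.sub_im, abs_of_pos (by linarith), abs_of_pos (by linarith)]
  linarith

theorem Separated.mul_norm_lt {K j j' : ℕ} (h : Separated K j j') {u v w : ℂ}
    (hu : (u : Sphere) ∈ basicSet j) (hv : (v : Sphere) ∈ basicSet j)
    (hw : (w : Sphere) ∈ basicSet j') : K * ‖u - v‖ < ‖w - v‖ := by
  obtain ⟨hj, hj', h⟩ := h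
  have hu := norm_sub_corner_lt hj hu
  have hv := norm_sub_corner_lt hj hv
  have hw := norm_sub_corner_lt hj' hw
  have huv : ‖u - v‖ ≤ 2 * (width j + height j) := by
    linarith [norm_sub_le_norm_sub_add_norm_sub u (corner j) v, norm_sub_rev v (corner j)]
  have hK : K * ‖u - v‖ ≤ K * (2 * (width j + height j)) := by gcongr
  linarith [norm_sub_le_norm_sub_add_norm_sub (corner j) v (corner j'), norm_sub_rev v (corner j),
    norm_sub_le_norm_sub_add_norm_sub v w (corner j'), norm_sub_rev v w]

theorem exists_separated (K : ℕ) {v w : ℂ} (hne : v ≠ w) :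
    ∃ j j', (v : Sphere) ∈ basicSet j ∧ (w : Sphere) ∈ basicSet j' ∧ Separated K j j' := by
  have hη : 0 < ‖v - w‖ / (2 * K + 4) :=
    div_pos (norm_pos_iff.2 (sub_ne_zero.2 hne)) (by positivity)
  have hη_mul : (2 * K + 4) * (‖v - w‖ / (2 * K + 4)) = ‖v - w‖ := by field_simp
  set η := ‖v - w‖ / (2 * K + 4)
  obtain ⟨j, hj, hv, hsize⟩ := exists_mem_basicSet_width_add_height_lt v hη
  obtain ⟨j', hj', hw, hsize'⟩ := exists_mem_basicSet_width_add_height_lt w hη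
  refine ⟨j, j', hv, hw, hj, hj', ?_⟩
  have hv := norm_sub_corner_lt hj hv
  have hw := norm_sub_corner_lt hj' hw
  have hK : (2 * K + 1) * (width j + height j) ≤ (2 * K + 1) * η := by gcongr
  linarith [norm_sub_le_norm_sub_add_norm_sub v (corner j) w, norm_sub_rev w (corner j'),
    norm_sub_le_norm_sub_add_norm_sub (corner j) (corner j') w]

variable {α : Type*} [Primcodable α] {z : α → ℂ} {r : α → ℝ} {k : α → ℕ}

theorem primrecPred_lt_norm (hr : RatPrimrec r) (hr0 : ∀ a, 0 ≤ r a)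
    (hre : RatPrimrec fun a => (z a).re) (him : RatPrimrec fun a => (z a).im) :
    PrimrecPred fun a => r a < ‖z a‖ :=
  (hr.sq.lt (hre.sq.add him.sq)).of_eq fun a => by
    rw [← sq_lt_sq₀ (hr0 a) (norm_nonneg _), Complex.sq_norm, Complex.normSq_apply, sq (z a).re,
      sq (z a).im]

theorem ratPrimrec_re_pointOf {m : α → ℕ} (hm : Primrec m) :
    RatPrimrec fun a => (pointOf (m a)).re :=
  .ratOf (Primrec.fst.comp (Primrec.unpair.comp hm))

theorem ratPrimrec_im_pointOf {m : α → ℕ} (hm : Primrec m) :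
    RatPrimrec fun a => (pointOf (m a)).im :=
  .ratOf (Primrec.snd.comp (Primrec.unpair.comp hm))

theorem primrec_unpair_half (hk : Primrec k) : Primrec fun a => (k a / 2).unpair :=
  Primrec.unpair.comp (Primrec.nat_div.comp hk (.const 2))

theorem ratPrimrec_re_corner (hk : Primrec k) : RatPrimrec fun a => (corner (k a)).re :=
  ratPrimrec_re_pointOf (Primrec.fst.comp (primrec_unpair_half hk))

theorem ratPrimrec_im_corner (hk : Primrec k) : RatPrimrec fun a => (corner (k a)).im :=
  ratPrimrec_im_pointOf (Primrec.fst.comp (primrec_unpair_half hk))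

theorem ratPrimrec_width (hk : Primrec k) : RatPrimrec fun a => width (k a) :=
  .posRatOf (Primrec.fst.comp (Primrec.unpair.comp (Primrec.snd.comp (primrec_unpair_half hk))))

theorem ratPrimrec_height (hk : Primrec k) : RatPrimrec fun a => height (k a) :=
  .posRatOf (Primrec.snd.comp (Primrec.unpair.comp (Primrec.snd.comp (primrec_unpair_half hk))))

theorem primrecPred_even (hk : Primrec k) : PrimrecPred fun a => k a % 2 = 0 :=
  Primrec.eq.comp (Primrec.nat_mod.comp hk (.const 2)) (.const 0)

theorem primrecPred_image_closedBall_subset_basicSet (hr : RatPrimrec r) (hr0 : ∀ a, 0 ≤ r a)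
    (hre : RatPrimrec fun a => (z a).re) (him : RatPrimrec fun a => (z a).im) (hk : Primrec k) :
    PrimrecPred fun a => (↑) '' closedBall (z a) (r a) ⊆ basicSet (k a) := by
  have heven := primrecPred_even hk
  have hx := ratPrimrec_re_corner hk
  have hy := ratPrimrec_im_corner hk
  have hrect := (hx.lt (hre.sub hr)).and <| ((hre.add hr).lt (hx.add (ratPrimrec_width hk))).and <|
    (hy.lt (him.sub hr)).and ((him.add hr).lt (hy.add (ratPrimrec_height hk)))
  have hdisk := primrecPred_lt_norm (hr.add (.posRatOf (Primrec.nat_div.comp hk (.const 2))))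
    (fun a => add_nonneg (hr0 a) (Rat.cast_nonneg.2 (posRatOf_pos _).le)) hre him
  refine ((heven.and hrect).or (heven.not.and hdisk)).of_eq fun a => ?_
  by_cases hka : k a % 2 = 0
  · simp only [hka, image_closedBall_subset_basicSet_of_even hka (hr0 a), true_and, not_true,
      false_and, or_false]
  · simp only [hka, image_closedBall_subset_basicSet_of_odd hka (hr0 a), false_and,
      not_false_eq_true, true_and, false_or]

theorem primrecPred_coe_pointOf_mem_basicSet {m : α → ℕ} (hm : Primrec m) (hk : Primrec k) :
    PrimrecPred fun a => (pointOf (m a) : Sphere) ∈ basicSet (k a) :=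
  (primrecPred_image_closedBall_subset_basicSet (.natCast 0) (fun _ => Nat.cast_nonneg 0)
    (ratPrimrec_re_pointOf hm) (ratPrimrec_im_pointOf hm) hk).of_eq fun a => by simp

theorem primrecPred_dist_pointOf_le {m m' : α → ℕ} (hm : Primrec m) (hm' : Primrec m')
    (hr : RatPrimrec r) (hr0 : ∀ a, 0 ≤ r a) :
    PrimrecPred fun a => dist (pointOf (m a)) (pointOf (m' a)) ≤ r a :=
  (primrecPred_lt_norm (z := fun a => pointOf (m a) - pointOf (m' a)) hr hr0
    ((ratPrimrec_re_pointOf hm).sub (ratPrimrec_re_pointOf hm'))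
    ((ratPrimrec_im_pointOf hm).sub (ratPrimrec_im_pointOf hm'))).not.of_eq fun a => by
      rw [not_lt, dist_eq_norm]

theorem primrecPred_separated (K : ℕ) {j j' : α → ℕ} (hj : Primrec j) (hj' : Primrec j') :
    PrimrecPred fun a => Separated K (j a) (j' a) := by
  have hK : RatPrimrec fun _ : α => (2 * K + 1 : ℝ) := by
    simpa using RatPrimrec.natCast (α := α) (2 * K + 1)
  have hsize := (hK.mul ((ratPrimrec_width hj).add (ratPrimrec_height hj))).add
    ((ratPrimrec_width hj').add (ratPrimrec_height hj'))
  have hpos (k : ℕ) : 0 ≤ width k + height k := (add_pos (width_pos k) (height_pos k)).le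
  have hnonneg (a : α) : 0 ≤ (2 * K + 1) * (width (j a) + height (j a)) +
      (width (j' a) + height (j' a)) :=
    add_nonneg (mul_nonneg (by positivity) (hpos _)) (hpos _)
  exact (primrecPred_even hj).and <| (primrecPred_even hj').and <|
    primrecPred_lt_norm (z := fun a => corner (j a) - corner (j' a)) hsize hnonneg
      ((ratPrimrec_re_corner hj).sub (ratPrimrec_re_corner hj'))
      ((ratPrimrec_im_corner hj).sub (ratPrimrec_im_corner hj'))

end BasicSets

section BoundaryBehavior

variable {X Y : Type*} [TopologicalSpace X] [TopologicalSpace Y] {f : X → Y} {D : Set X} {ζ : X}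
  {w : Y}

theorem notMem_image_of_mapClusterPt [T2Space X] (hinj : InjOn f D)
    (hopen : ∀ p ∈ D, 𝓝 (f p) ≤ map f (𝓝[D] p)) (hζ : ζ ∉ D)
    (hw : MapClusterPt w (𝓝[D] ζ) f) : w ∉ f '' D := by
  rintro ⟨p, hp, rfl⟩
  obtain ⟨U, V, hU, hV, hpU, hζV, hUV⟩ := t2_separation (ne_of_mem_of_not_mem hp hζ)
  have hfU : f '' (D ∩ U) ∈ 𝓝 (f p) := hopen p hp <| image_mem_map <|
    inter_mem_nhdsWithin D (hU.mem_nhds hpU)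
  have hVD : D ∩ V ∈ 𝓝[D] ζ := inter_mem_nhdsWithin D (hV.mem_nhds hζV)
  obtain ⟨z, ⟨u, hu, huz⟩, hz⟩ :=
    ((mapClusterPt_iff_frequently.1 hw _ hfU).and_eventually hVD).exists
  obtain rfl : u = z := hinj hu.1 hz.1 huz
  exact hUV.notMem_of_mem_left hu.2 hz.2

theorem exists_mapClusterPt_mem_frontier_image [T2Space X] [CompactSpace Y] (hD : IsOpen D)
    (hinj : InjOn f D) (hopen : ∀ p ∈ D, 𝓝 (f p) ≤ map f (𝓝[D] p)) (hζ : ζ ∈ frontier D) :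
    ∃ w ∈ frontier (f '' D), MapClusterPt w (𝓝[D] ζ) f := by
  rw [hD.frontier_eq] at hζ
  have : (𝓝[D] ζ).NeBot := mem_closure_iff_nhdsWithin_neBot.1 hζ.1
  obtain ⟨w, hw⟩ := exists_clusterPt_of_compactSpace (map f (𝓝[D] ζ))
  refine ⟨w, ⟨?_, fun hwint => notMem_image_of_mapClusterPt hinj hopen hζ.2 hw
    (interior_subset hwint)⟩, hw⟩
  exact mem_closure_iff_clusterPt.2 <| hw.mono <| le_principal_iff.2 <|
    image_mem_map self_mem_nhdsWithin

theorem inter_frontier_nonempty_of_isPreconnected {S : Set X} (hS : IsPreconnected S)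
    (hSD : (S ∩ D).Nonempty) (hSD' : ¬S ⊆ D) : (S ∩ frontier D).Nonempty := by
  by_contra! h
  refine hSD' ((hS.subset_left_of_subset_union isOpen_interior isClosed_closure.isOpen_compl
    (disjoint_compl_right.mono_left (interior_subset.trans subset_closure)) (fun x hx => ?_)
    ?_).trans interior_subset)
  · by_contra! hx'
    simp only [mem_union, mem_compl_iff, not_or, not_not] at hx'
    exact h.subset ⟨hx, hx'.2, hx'.1⟩
  · obtain ⟨x, hxS, hxD⟩ := hSD
    by_contra! hx
    exact h.subset ⟨hxS, subset_closure hxD, fun hxint => hx.subset ⟨hxS, hxint⟩⟩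

end BoundaryBehavior

section ConformalMaps

variable {f : Sphere → Sphere} {D C : Set Sphere} {p : Sphere}

theorem nhds_infty_eq_cobounded :
    𝓝 (∞ : Sphere) = map (↑) (Bornology.cobounded ℂ) ⊔ pure ∞ := by
  rw [OnePoint.nhds_infty_eq, coclosedCompact_eq_cocompact, Metric.cobounded_eq_cocompact]

theorem tendsto_coe_cobounded_nhds_infty :
    Tendsto (fun z : ℂ => (z : Sphere)) (Bornology.cobounded ℂ) (𝓝 ∞) :=
  nhds_infty_eq_cobounded ▸ le_sup_left

theorem IsNormalizedAtInfinity.map_infty (h : IsNormalizedAtInfinity f)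
    (hf : ContinuousAt f ∞) : f ∞ = ∞ := by
  obtain ⟨g, hfg, hg⟩ := h
  have hg0 : Tendsto (fun z => g z - z) (Bornology.cobounded ℂ) (𝓝 0) :=
    hg.trans_tendsto tendsto_inv₀_cobounded
  have hgtop : Tendsto g (Bornology.cobounded ℂ) (Bornology.cobounded ℂ) := by
    rw [← tendsto_norm_atTop_iff_cobounded]
    refine tendsto_atTop_mono (fun z => ?_)
      (tendsto_norm_cobounded_atTop.atTop_add hg0.norm.neg)
    linarith [norm_le_norm_add_norm_sub (g z) z]
  refine tendsto_nhds_unique (hf.tendsto.comp tendsto_coe_cobounded_nhds_infty) ?_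
  exact (tendsto_coe_cobounded_nhds_infty.comp hgtop).congr' (hfg.mono fun z hz => hz.symm)

theorem param_zero (p : Sphere) : param p 0 = p := by
  induction p using OnePoint.rec with
  | infty => simp [param]
  | coe a => simp [param]

theorem param_injective (p : Sphere) : Function.Injective (param p) := by
  intro u v huv
  induction p using OnePoint.rec with
  | infty =>
    by_cases hu : u = 0 <;> by_cases hv : v = 0 <;> simp_all [param]
  | coe a => simpa [param] using huv

theorem map_param_nhds_zero (p : Sphere) : map (param p) (𝓝 0) = 𝓝 p := by
  induction p using OnePoint.rec with
  | infty =>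
    have hinv : map (param ∞) (𝓝[≠] 0) = map (↑) (Bornology.cobounded ℂ) := by
      rw [← inv_nhdsNE_zero, ← Filter.map_inv, map_map]
      exact Filter.map_congr (eventually_mem_nhdsWithin.mono fun w hw => if_neg hw)
    rw [← nhdsNE_sup_pure, Filter.map_sup, hinv, Filter.map_pure, param_zero,
      nhds_infty_eq_cobounded]
  | coe a =>
    rw [OnePoint.nhds_coe_eq, ← map_add_left_nhds_zero a, map_map]
    rfl

/-- Unlike `param`, the coordinate `coord` is not centered, hence the translation. -/
theorem eventually_param_coord_sub_eq (p : Sphere) :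
    ∀ᶠ z in 𝓝 p, param p (coord p z - coord p p) = z := by
  induction p using OnePoint.rec with
  | infty =>
    filter_upwards [isOpen_compl_singleton.mem_nhds (OnePoint.infty_ne_coe (0 : ℂ))] with z hz
    induction z using OnePoint.rec with
    | infty => simp [param, coord]
    | coe w =>
      have hw : w ≠ 0 := by rintro rfl; exact hz rfl
      simp [param, coord, hw]
  | coe a =>
    filter_upwards [isOpen_compl_singleton.mem_nhds (OnePoint.coe_ne_infty a)] with z hz
    obtain ⟨w, rfl⟩ := OnePoint.ne_infty_iff_exists.1 hz
    simp [param, coord]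

theorem HolomorphicAt.nhds_le_map_nhds (hf : HolomorphicAt f p) (hD : D ∈ 𝓝 p)
    (hinj : InjOn f D) : 𝓝 (f p) ≤ map f (𝓝 p) := by
  set g : ℂ → ℂ := fun w => coord (f p) (f (param p w)) with hg
  have hg0 : g 0 = coord (f p) (f p) := by simp only [hg, param_zero]
  have hparam : Tendsto (param p) (𝓝 0) (𝓝 p) := (map_param_nhds_zero p).le
  have hfg : ∀ᶠ w in 𝓝 0, param (f p) (g w - g 0) = f (param p w) := by
    rw [hg0]
    exact (hf.1.tendsto.comp hparam).eventually (eventually_param_coord_sub_eq (f p))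
  rcases hf.2.eventually_constant_or_nhds_le_map_nhds with hconst | hopen
  · -- An injective map is not locally constant.
    have hev : ∀ᶠ w in 𝓝[≠] (0 : ℂ), g w = g 0 ∧ param (f p) (g w - g 0) = f (param p w) ∧
        param p w ∈ D := nhdsWithin_le_nhds (hconst.and (hfg.and (hparam hD)))
    obtain ⟨w, ⟨hgw, hfw, hwD⟩, hw⟩ := (hev.and self_mem_nhdsWithin).exists
    rw [hgw, sub_self, param_zero] at hfw
    refine absurd (param_injective p ?_) hw
    rw [param_zero]
    exact hinj hwD (mem_of_mem_nhds hD) hfw.symm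
  · calc 𝓝 (f p) = map (fun u => param (f p) (u - g 0)) (𝓝 (g 0)) := by
          have hsub : map (· - g 0) (𝓝 (g 0)) = 𝓝 0 := by
            simp [sub_eq_add_neg, map_add_right_nhds]
          rw [← map_param_nhds_zero (f p), ← hsub, map_map]
          rfl
      _ ≤ map (fun u => param (f p) (u - g 0)) (map g (𝓝 0)) := map_mono hopen
      _ = map f (map (param p) (𝓝 0)) := map_congr hfg
      _ = map f (𝓝 p) := by rw [map_param_nhds_zero]

/-- The map of the plane into itself that `f` induces, with the junk value `0` where `f` takes the
value `∞`. -/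
def planeMap (f : Sphere → Sphere) (z : ℂ) : ℂ :=
  (f z).elim 0 fun w => w

theorem coe_planeMap {z : ℂ} (h : f z ≠ ∞) : (planeMap f z : Sphere) = f z := by
  obtain ⟨w, hw⟩ := OnePoint.ne_infty_iff_exists.1 h
  simp [planeMap, ← hw]

theorem HolomorphicAt.analyticAt_planeMap {a : ℂ} (hf : HolomorphicAt f a) (h : f a ≠ ∞) :
    AnalyticAt ℂ (planeMap f) a := by
  obtain ⟨b, hb⟩ := OnePoint.ne_infty_iff_exists.1 h
  have hcoord : AnalyticAt ℂ (fun w => planeMap f (a + w)) 0 := by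
    have := hf.2
    rwa [← hb] at this
  have hcomp := hcoord.comp_of_eq (analyticAt_id.sub analyticAt_const) (sub_self a)
  simpa [Function.comp_def] using hcomp

theorem IsConformalMap.map_coe_ne_infty (hf : IsConformalMap f D C) (hD : ∞ ∈ D)
    (hinf : f ∞ = ∞) {z : ℂ} (hz : (z : Sphere) ∈ D) : f z ≠ ∞ := fun h =>
  OnePoint.coe_ne_infty z (hf.2.injOn hz hD (h.trans hinf.symm))

theorem IsConformalMap.norm_planeMap_sub_le (hf : IsConformalMap f D C) {c z ω : ℂ} {R : ℝ}
    (hR : 0 < R) (hball : ∀ u ∈ ball c R, (u : Sphere) ∈ D)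
    (hfin : ∀ u ∈ ball c R, f u ≠ ∞) (hω : (ω : Sphere) ∉ C) (hz : dist z c ≤ R / 2) :
    ‖planeMap f z - ω‖ ≤ Real.exp 16 * ‖planeMap f c - ω‖ := by
  refine norm_le_exp_mul_of_injOn (F := fun u => planeMap f u - ω) hR (fun u hu => ?_)
    (fun u hu h => ?_) (fun u hu v hv huv => ?_) hz
  · exact (((hf.1 u (hball u hu)).analyticAt_planeMap
      (hfin u hu)).differentiableAt.sub_const ω).differentiableWithinAt
  · rw [← sub_eq_zero.1 h, coe_planeMap (hfin u hu)] at hω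
    exact hω (hf.2.mapsTo (hball u hu))
  · refine OnePoint.coe_injective (hf.2.injOn (hball u hu) (hball v hv) ?_)
    rw [← coe_planeMap (hfin u hu), ← coe_planeMap (hfin v hv), sub_left_injective huv]

theorem IsConformalMap.exists_mapClusterPt_mem_frontier (hf : IsConformalMap f D C)
    (hDo : IsOpen D) {ζ : Sphere} (hζ : ζ ∈ frontier D) :
    ∃ w ∈ frontier C, MapClusterPt w (𝓝[D] ζ) f := by
  rw [← hf.2.image_eq]
  refine exists_mapClusterPt_mem_frontier_image hDo hf.2.injOn (fun p hp => ?_) hζ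
  rw [hDo.nhdsWithin_eq hp]
  exact (hf.1 p hp).nhds_le_map_nhds (hDo.mem_nhds hp) hf.2.injOn

theorem IsConformalMap.isOpen (hf : IsConformalMap f D C) (hDo : IsOpen D) : IsOpen C := by
  rw [← hf.2.image_eq, isOpen_iff_mem_nhds]
  rintro _ ⟨p, hp, rfl⟩
  exact (hf.1 p hp).nhds_le_map_nhds (hDo.mem_nhds hp) hf.2.injOn
    (image_mem_map (hDo.mem_nhds hp))

theorem IsConformalMap.exists_pointOf_mem (hf : IsConformalMap f D C) (hDo : IsOpen D) {ζ : ℂ}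
    {w : Sphere} (hw : MapClusterPt w (𝓝[D] (ζ : Sphere)) f) {U : Set ℂ} (hU : U ∈ 𝓝 ζ)
    {W : Set Sphere} (hW : W ∈ 𝓝 w) :
    ∃ m, pointOf m ∈ U ∧ (pointOf m : Sphere) ∈ D ∧ f (pointOf m) ∈ W := by
  have hcont : ContinuousOn f D := fun p hp => (hf.1 p hp).1.continuousWithinAt
  have hopen : IsOpen ((↑) ⁻¹' (D ∩ f ⁻¹' interior W) : Set ℂ) :=
    (hcont.isOpen_inter_preimage hDo isOpen_interior).preimage OnePoint.continuous_coe
  have hev : ∀ᶠ z in 𝓝[D] (ζ : Sphere), z ∈ (↑) '' interior U ∧ z ∈ D :=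
    inter_mem (mem_nhdsWithin_of_mem_nhds ((OnePoint.isOpen_image_coe.2 isOpen_interior).mem_nhds
      ⟨ζ, mem_interior_iff_mem_nhds.2 hU, rfl⟩)) self_mem_nhdsWithin
  obtain ⟨_, hfu, ⟨u, hu, rfl⟩, huD⟩ :=
    ((mapClusterPt_iff_frequently.1 hw _ (interior_mem_nhds.2 hW)).and_eventually hev).exists
  obtain ⟨m, hmU, hmD, hmW⟩ := denseRange_pointOf.exists_mem_open
    (isOpen_interior.inter hopen) ⟨u, hu, huD, hfu⟩
  exact ⟨m, interior_subset hmU, hmD, interior_subset hmW⟩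

end ConformalMaps

section Certificates

variable {f : Sphere → Sphere} {D C : Set Sphere}

theorem exists_coe_eq_of_mem_frontier (hD : IsOpen D) (hDinf : ∞ ∈ D) {w : Sphere}
    (hw : w ∈ frontier D) : ∃ ω : ℂ, (ω : Sphere) = w ∧ (ω : Sphere) ∉ D := by
  rw [hD.frontier_eq] at hw
  obtain ⟨ω, rfl⟩ := OnePoint.ne_infty_iff_exists.1 (ne_of_mem_of_not_mem hDinf hw.2).symm
  exact ⟨ω, rfl, hw.2⟩

theorem IsConformalMap.exists_mem_ball_frontier (hf : IsConformalMap f D C) (hDinf : ∞ ∈ D)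
    (hinf : f ∞ = ∞) {c z ω : ℂ} {R : ℝ} (hR : 0 < R) (hc : (c : Sphere) ∈ D)
    (hz : dist z c ≤ R / 2) (hω : (ω : Sphere) ∉ C)
    (h : Real.exp 16 * ‖planeMap f c - ω‖ < ‖planeMap f z - ω‖) :
    ∃ u ∈ ball c R, (u : Sphere) ∈ frontier D := by
  have hconn : IsPreconnected ((↑) '' ball c R : Set Sphere) :=
    (convex_ball c R).isPreconnected.image _ OnePoint.continuous_coe.continuousOn
  have hnot : ¬((↑) '' ball c R : Set Sphere) ⊆ D := fun hball => by
    rw [image_subset_iff] at hball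
    exact h.not_ge <| hf.norm_planeMap_sub_le hR hball
      (fun u hu => hf.map_coe_ne_infty hDinf hinf (hball hu)) hω hz
  obtain ⟨_, ⟨u, hu, rfl⟩, huD⟩ := inter_frontier_nonempty_of_isPreconnected hconn
    ⟨c, mem_image_of_mem _ (mem_ball_self hR), hc⟩ hnot
  exact ⟨u, hu, huD⟩

/-- The constant of the distortion theorem, rounded up. -/
noncomputable def distortionConstant : ℕ := ⌈Real.exp 16⌉₊

/-- The numbers `m`, `m'`, `e`, `j`, `j'` certify that the basic set `k` meets the boundary of `D`:
it contains the disk of radius `2 * posRatOf e` around `pointOf m`, and `f` distorts too much for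
this disk to lie in `D`, since compared with `f (pointOf m)` the image of the nearby point
`pointOf m'` is far away from a boundary point of `C`. -/
structure IsBoundaryCertificate (f : Sphere → Sphere) (D C : Set Sphere)
    (k m m' e j j' : ℕ) : Prop where
  mem : (pointOf m : Sphere) ∈ D
  mem' : (pointOf m' : Sphere) ∈ D
  map_mem : f (pointOf m) ∈ basicSet j
  map_mem' : f (pointOf m') ∈ basicSet j'
  inter_frontier_nonempty : (basicSet j ∩ frontier C).Nonempty
  separated : Separated distortionConstant j j'
  dist_le : dist (pointOf m') (pointOf m) ≤ posRatOf e
  closedBall_subset : (↑) '' closedBall (pointOf m) (2 * posRatOf e) ⊆ basicSet k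

theorem IsBoundaryCertificate.basicSet_inter_frontier_nonempty {k m m' e j j' : ℕ}
    (h : IsBoundaryCertificate f D C k m m' e j j') (hf : IsConformalMap f D C) (hD : IsOpen D)
    (hDinf : ∞ ∈ D) (hinf : f ∞ = ∞) : (basicSet k ∩ frontier D).Nonempty := by
  obtain ⟨w, hwj, hw⟩ := h.inter_frontier_nonempty
  have hCinf : ∞ ∈ C := hinf ▸ hf.2.mapsTo hDinf
  obtain ⟨ω, rfl, hωC⟩ := exists_coe_eq_of_mem_frontier (hf.isOpen hD) hCinf hw
  have hfar : distortionConstant * ‖planeMap f (pointOf m) - ω‖ <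
      ‖planeMap f (pointOf m') - ω‖ := by
    refine h.separated.mul_norm_lt ?_ hwj ?_
    · rw [coe_planeMap (hf.map_coe_ne_infty hDinf hinf h.mem)]
      exact h.map_mem
    · rw [coe_planeMap (hf.map_coe_ne_infty hDinf hinf h.mem')]
      exact h.map_mem'
  have he : (0 : ℝ) < posRatOf e := Rat.cast_pos.2 (posRatOf_pos e)
  obtain ⟨u, hu, huD⟩ := hf.exists_mem_ball_frontier hDinf hinf (R := 2 * posRatOf e)
    (by positivity) h.mem (by linarith [h.dist_le]) hωC <|
      (mul_le_mul_of_nonneg_right (Nat.le_ceil _) (norm_nonneg _)).trans_lt hfar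
  exact ⟨u, h.closedBall_subset (mem_image_of_mem _ (ball_subset_closedBall hu)), huD⟩

theorem IsConformalMap.exists_isBoundaryCertificate (hf : IsConformalMap f D C) (hD : IsOpen D)
    (hDinf : ∞ ∈ D) (hinf : f ∞ = ∞) {k : ℕ} (hk : (basicSet k ∩ frontier D).Nonempty) :
    ∃ m m' e j j', IsBoundaryCertificate f D C k m m' e j j' := by
  obtain ⟨_, hζk, hζD⟩ := hk
  obtain ⟨ζ, rfl, -⟩ := exists_coe_eq_of_mem_frontier hD hDinf hζD
  obtain ⟨w, hwC, hw⟩ := hf.exists_mapClusterPt_mem_frontier hD hζD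
  have hCinf : ∞ ∈ C := hinf ▸ hf.2.mapsTo hDinf
  obtain ⟨ω, rfl, hωC⟩ := exists_coe_eq_of_mem_frontier (hf.isOpen hD) hCinf hwC
  obtain ⟨δ, hδ, hδk⟩ := Metric.isOpen_iff.1
    ((isOpen_basicSet k).preimage OnePoint.continuous_coe) ζ hζk
  obtain ⟨s, hδs, hsδ⟩ := exists_rat_btwn (show δ / 4 < δ / 3 by linarith)
  obtain ⟨e, rfl⟩ := exists_posRatOf_eq (Rat.cast_pos.1 ((div_pos hδ four_pos).trans hδs))
  have hball : ball ζ (δ / 8) ∈ 𝓝 ζ := ball_mem_nhds ζ (by positivity)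
  obtain ⟨m', hm', hm'D, -⟩ := hf.exists_pointOf_mem hD hw hball univ_mem
  have hfm' := coe_planeMap (hf.map_coe_ne_infty hDinf hinf hm'D)
  have hne : ω ≠ planeMap f (pointOf m') := by
    rintro rfl
    exact hωC (hfm' ▸ hf.2.mapsTo hm'D)
  obtain ⟨j, j', hωj, hj', hsep⟩ := exists_separated distortionConstant hne
  obtain ⟨m, hm, hmD, hmj⟩ := hf.exists_pointOf_mem hD hw hball
    ((isOpen_basicSet j).mem_nhds hωj)
  rw [mem_ball] at hm hm'
  refine ⟨m, m', e, j, j', hmD, hm'D, hmj, hfm' ▸ hj', ⟨ω, hωj, hwC⟩, hsep, ?_, ?_⟩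
  · linarith [dist_triangle_right (pointOf m') (pointOf m) ζ]
  · rw [image_subset_iff]
    exact (closedBall_subset_ball' (by linarith)).trans hδk

end Certificates

section Tape

theorem join_two_mul (p q : ℕ → ℕ) (i : ℕ) : join p q (2 * i) = p i := by
  simp [join]

theorem join_two_mul_add_one (p q : ℕ → ℕ) (i : ℕ) : join p q (2 * i + 1) = q i := by
  simp [join, Nat.mul_add_div]

section

variable (p n q r : ℕ → ℕ) (i : ℕ)

theorem join_join_four_mul : join (join p n) (join q r) (4 * i) = p i := by
  rw [show 4 * i = 2 * (2 * i) by ring, join_two_mul, join_two_mul]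

theorem join_join_four_mul_add_one : join (join p n) (join q r) (4 * i + 1) = q i := by
  rw [show 4 * i + 1 = 2 * (2 * i) + 1 by ring, join_two_mul_add_one, join_two_mul]

theorem join_join_four_mul_add_three : join (join p n) (join q r) (4 * i + 3) = r i := by
  rw [show 4 * i + 3 = 2 * (2 * i + 1) + 1 by ring, join_two_mul_add_one, join_two_mul_add_one]

end

theorem exists_mem_basicSet_closure_subset {U : Set Sphere} (hU : IsOpen U) {z : ℂ}
    (hz : (z : Sphere) ∈ U) : ∃ a, (z : Sphere) ∈ basicSet a ∧ closure (basicSet a) ⊆ U := by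
  obtain ⟨δ, hδ, hδU⟩ := Metric.isOpen_iff.1 (hU.preimage OnePoint.continuous_coe) z hz
  obtain ⟨a, ha, hza, hsize⟩ := exists_mem_basicSet_width_add_height_lt z (div_pos hδ four_pos)
  refine ⟨a, hza, ?_⟩
  have hclosed : IsClosed ((↑) '' closedBall z (δ / 2) : Set Sphere) :=
    ((isCompact_closedBall z (δ / 2)).image OnePoint.continuous_coe).isClosed
  refine (closure_minimal (fun w hw => ?_) hclosed).trans
    (image_subset_iff.2 ((closedBall_subset_ball (half_lt_self hδ)).trans hδU))
  obtain ⟨u, rfl⟩ : ∃ u : ℂ, (u : Sphere) = w := by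
    rw [basicSet, if_pos ha] at hw
    exact hw.imp fun u hu => hu.2
  refine mem_image_of_mem _ (mem_closedBall_iff_norm.2 ?_)
  linarith [norm_sub_corner_lt ha hza, norm_sub_corner_lt ha hw, norm_sub_rev z (corner a),
    norm_sub_le_norm_sub_add_norm_sub u (corner a) z]

open Classical in
/-- The standard name of the rational point with code `m`. -/
noncomputable def pointName (m k : ℕ) : ℕ :=
  if (pointOf m : Sphere) ∈ basicSet k then k + 1 else 0

theorem namesPoint_pointName (m : ℕ) : NamesPoint (pointName m) (pointOf m) := fun k => by
  refine ⟨fun hk => ⟨k, if_pos hk⟩, ?_⟩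
  rintro ⟨i, hi⟩
  unfold pointName at hi
  split_ifs at hi with h
  rwa [Nat.succ.inj hi] at h

theorem primrec₂_pointName : Primrec₂ pointName := by
  classical
  exact .ite (primrecPred_coe_pointOf_mem_basicSet .fst .snd) (Primrec.succ.comp .snd) (.const 0)

/-- The name of a domain on the tape `O` confirms that it contains the rational point `m`. -/
def ConfirmsMem (O : ℕ → ℕ) (m : ℕ) : Prop :=
  ∃ a i, O (4 * i) = a + 1 ∧ (pointOf m : Sphere) ∈ basicSet a

/-- The name of a function on the tape `O` confirms that the value at the rational point `m` lies
in the basic set `j`. The name consists of the cells `4 * i + 1`, and the program is its first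
entry. -/
def ConfirmsMapMem (O : ℕ → ℕ) (m j : ℕ) : Prop :=
  ∃ e u, O 1 = e ∧
    j + 1 ∈ (OracleCode.ofNat e).eval (join (pointName m) fun i => O (4 * (i + 1) + 1)) u

/-- The name of a closed set on the tape `O` confirms that it meets the basic set `j`. -/
def ConfirmsMeets (O : ℕ → ℕ) (j : ℕ) : Prop :=
  ∃ i, O (4 * i + 3) = j + 1

section

variable {p q r : ℕ → ℕ} {f : Sphere → Sphere} {D F : Set Sphere}

theorem NamesOpen.confirmsMem_iff (hp : NamesOpen p D) (hD : IsOpen D) (n q r : ℕ → ℕ) {m : ℕ} :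
    ConfirmsMem (join (join p n) (join q r)) m ↔ (pointOf m : Sphere) ∈ D := by
  simp only [ConfirmsMem, join_join_four_mul]
  constructor
  · rintro ⟨a, i, hi, hma⟩
    exact (hp a).2 ⟨i, hi⟩ (subset_closure hma)
  · intro hm
    obtain ⟨a, hma, haD⟩ := exists_mem_basicSet_closure_subset hD hm
    obtain ⟨i, hi⟩ := (hp a).1 haD
    exact ⟨a, i, hi, hma⟩

theorem NamesFun.confirmsMapMem_iff (hq : NamesFun q D f) (p n r : ℕ → ℕ) {m j : ℕ}
    (hm : (pointOf m : Sphere) ∈ D) :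
    ConfirmsMapMem (join (join p n) (join q r)) m j ↔ f (pointOf m) ∈ basicSet j := by
  obtain ⟨c, X, hc, hX, hcomp⟩ := hq
  obtain ⟨s, hs, hsf⟩ := hcomp _ hm _ (namesPoint_pointName m)
  have hprogram : join (join p n) (join q r) 1 = c.encode := by
    simpa [hc] using join_join_four_mul_add_one p n q r 0
  have horacle : (fun i => join (join p n) (join q r) (4 * (i + 1) + 1)) = charSeq X :=
    funext fun i => by rw [join_join_four_mul_add_one, hX]
  simp only [ConfirmsMapMem, exists_and_left, exists_eq_left', hprogram, horacle,
    OracleCode.ofNat_encode, hs _, Part.mem_some_iff]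
  exact (exists_congr fun u => eq_comm).trans (hsf j).symm

theorem NamesClosed.confirmsMeets_iff (hr : NamesClosed r F) (p n q : ℕ → ℕ) {j : ℕ} :
    ConfirmsMeets (join (join p n) (join q r)) j ↔ (basicSet j ∩ F).Nonempty := by
  simp only [ConfirmsMeets, join_join_four_mul_add_three]
  exact (hr j).symm

end

theorem semidecidable_confirmsMem : Semidecidable ConfirmsMem := by
  have h : Semidecidable fun O (x : (ℕ × ℕ) × ℕ) =>
      O (4 * x.2) = x.1.2 + 1 ∧ (pointOf x.1.1 : Sphere) ∈ basicSet x.1.2 :=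
    .and (.apply_eq (Primrec.nat_mul.comp (.const 4) .snd)
        (Primrec.succ.comp (Primrec.snd.comp .fst)))
      (.of_primrecPred (primrecPred_coe_pointOf_mem_basicSet
        (Primrec.fst.comp .fst) (Primrec.snd.comp .fst)))
  exact h.proj.proj

theorem semidecidable_confirmsMapMem :
    Semidecidable fun O (x : ℕ × ℕ) => ConfirmsMapMem O x.1 x.2 := by
  have h : Semidecidable fun O (x : ((ℕ × ℕ) × ℕ) × ℕ) => O 1 = x.1.2 ∧
      x.1.1.2 + 1 ∈ (OracleCode.ofNat x.1.2).eval
        (join (pointName x.1.1.1) fun i => O (4 * (i + 1) + 1)) x.2 :=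
    have hmj := Primrec.fst.comp .fst
    .and (.apply_eq (.const 1) (Primrec.snd.comp .fst)) <|
      .mem_eval (g := fun i => 4 * (i + 1) + 1) (Primrec.snd.comp .fst) .snd
        (Primrec.succ.comp (Primrec.snd.comp hmj))
        (primrec₂_pointName.comp (Primrec.fst.comp (hmj.comp .fst)) .snd)
        (Primrec.succ.comp (Primrec.nat_mul.comp (.const 4) .succ))
  exact h.proj.proj

theorem semidecidable_confirmsMeets : Semidecidable ConfirmsMeets := by
  have h : Semidecidable fun O (x : ℕ × ℕ) => O (4 * x.2 + 3) = x.1 + 1 :=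
    .apply_eq (Primrec.nat_add.comp (Primrec.nat_mul.comp (.const 4) .snd) (.const 3))
      (Primrec.succ.comp .fst)
  exact h.proj

/-- The names on the tape `O` confirm that the boundary of the domain meets the basic set `k`, by
way of an `IsBoundaryCertificate`. -/
def ConfirmsFrontierMeets (O : ℕ → ℕ) (k : ℕ) : Prop :=
  ∃ m m' e j j', ConfirmsMem O m ∧ ConfirmsMem O m' ∧ ConfirmsMapMem O m j ∧
    ConfirmsMapMem O m' j' ∧ ConfirmsMeets O j ∧ Separated distortionConstant j j' ∧
    dist (pointOf m') (pointOf m) ≤ posRatOf e ∧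
    (↑) '' closedBall (pointOf m) (2 * posRatOf e) ⊆ basicSet k

theorem semidecidable_confirmsFrontierMeets : Semidecidable ConfirmsFrontierMeets := by
  have hj : Primrec fun x : ((((ℕ × ℕ) × ℕ) × ℕ) × ℕ) × ℕ => x.1.2 := Primrec.snd.comp .fst
  have he : Primrec fun x : ((((ℕ × ℕ) × ℕ) × ℕ) × ℕ) × ℕ => x.1.1.2 :=
    Primrec.snd.comp (Primrec.fst.comp .fst)
  have hm' : Primrec fun x : ((((ℕ × ℕ) × ℕ) × ℕ) × ℕ) × ℕ => x.1.1.1.2 :=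
    Primrec.snd.comp (Primrec.fst.comp (Primrec.fst.comp .fst))
  have hkm : Primrec fun x : ((((ℕ × ℕ) × ℕ) × ℕ) × ℕ) × ℕ => x.1.1.1.1 :=
    Primrec.fst.comp (Primrec.fst.comp (Primrec.fst.comp .fst))
  have hk := Primrec.fst.comp hkm
  have hm := Primrec.snd.comp hkm
  have hradius := RatPrimrec.posRatOf he
  have hpos (e : ℕ) : (0 : ℝ) ≤ posRatOf e := Rat.cast_nonneg.2 (posRatOf_pos e).le
  have htwo : RatPrimrec fun _ : ((((ℕ × ℕ) × ℕ) × ℕ) × ℕ) × ℕ => (2 : ℝ) := .natCast 2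
  have h := (semidecidable_confirmsMem.comp hm).and <| (semidecidable_confirmsMem.comp hm').and <|
    (semidecidable_confirmsMapMem.comp (hm.pair hj)).and <|
    (semidecidable_confirmsMapMem.comp (hm'.pair .snd)).and <|
    (semidecidable_confirmsMeets.comp hj).and <| .of_primrecPred <|
    (primrecPred_separated distortionConstant hj .snd).and <|
    (primrecPred_dist_pointOf_le hm' hm hradius fun _ => hpos _).and <|
    primrecPred_image_closedBall_subset_basicSet (htwo.mul hradius)
      (fun _ => mul_nonneg zero_le_two (hpos _)) (ratPrimrec_re_pointOf hm)
      (ratPrimrec_im_pointOf hm) hk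
  exact h.proj.proj.proj.proj.proj

theorem confirmsFrontierMeets_iff {p q r : ℕ → ℕ} {f : Sphere → Sphere} {D C : Set Sphere}
    (hD : IsOpen D) (hDinf : ∞ ∈ D) (hf : IsConformalMap f D C) (hinf : f ∞ = ∞)
    (hp : NamesOpen p D) (hq : NamesFun q D f) (hr : NamesClosed r (frontier C)) (n : ℕ → ℕ)
    {k : ℕ} : ConfirmsFrontierMeets (join (join p n) (join q r)) k ↔
      (basicSet k ∩ frontier D).Nonempty := by
  simp only [ConfirmsFrontierMeets, hp.confirmsMem_iff hD, hr.confirmsMeets_iff]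
  constructor
  · rintro ⟨m, m', e, j, j', hm, hm', hmj, hmj', hj, hsep, hdist, hball⟩
    exact IsBoundaryCertificate.basicSet_inter_frontier_nonempty
      ⟨hm, hm', (hq.confirmsMapMem_iff p n r hm).1 hmj, (hq.confirmsMapMem_iff p n r hm').1 hmj',
        hj, hsep, hdist, hball⟩ hf hD hDinf hinf
  · intro hk
    obtain ⟨m, m', e, j, j', h⟩ := hf.exists_isBoundaryCertificate hD hDinf hinf hk
    exact ⟨m, m', e, j, j', h.mem, h.mem', (hq.confirmsMapMem_iff p n r h.mem).2 h.map_mem,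
      (hq.confirmsMapMem_iff p n r h.mem').2 h.map_mem', h.inter_frontier_nonempty, h.separated,
      h.dist_le, h.closedBall_subset⟩

end Tape

theorem exists_writes_fourth_of_join : ∃ c : OracleCode, ∀ p n q r : ℕ → ℕ,
    c.Writes (join (join p n) (join q r)) r := by
  obtain ⟨c, hc⟩ := OracleCode.exists_eval_eq_of_primrec (f := fun k => 4 * k + 3)
    (Primrec.nat_add.comp (Primrec.nat_mul.comp (.const 4) .id) (.const 3))
  refine ⟨.comp .oracle c, fun p n q r k => Part.eq_some_iff.2 <| OracleCode.mem_eval_comp.2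
    ⟨4 * k + 3, hc _ k ▸ Part.mem_some _, ?_⟩⟩
  rw [OracleCode.mem_eval_oracle, join_join_four_mul_add_three]

end SphereTTE

open SphereTTE in
theorem mainTheorem2_general :
    ∃ c c' : OracleCode, ∀ (D C : Set Sphere) (f : Sphere → Sphere) (p n q r : ℕ → ℕ),
      IsOpen D → ∞ ∈ D → IsConformalMap f D C → f ∞ = ∞ →
      NamesOpen p D → NamesFun q D f → NamesClosed r (frontier C) →
      (∃ s, c.Writes (join (join p n) (join q r)) s ∧ NamesClosed s (frontier D)) ∧
      ∃ s, c'.Writes (join (join p n) (join q r)) s ∧ NamesClosed s (frontier C) := by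
  obtain ⟨c, hc⟩ := semidecidable_confirmsFrontierMeets.exists_writes
  obtain ⟨c', hc'⟩ := exists_writes_fourth_of_join
  refine ⟨c, c', fun D C f p n q r hD hDinf hf hinf hp hq hr => ⟨?_, r, hc' p n q r, hr⟩⟩
  obtain ⟨s, hcs, hs⟩ := hc (join (join p n) (join q r))
  exact ⟨s, hcs, fun k =>
    (confirmsFrontierMeets_iff hD hDinf hf hinf hp hq hr n).symm.trans (hs k)⟩

open scoped OnePoint in
/-- There are fixed machines that, from a name `p` of a non-degenerate `n`-connected domain `D`
with `∞ ∈ D` and `0 ∉ D`, the number `n`, a name `q` of `f_D` and a name `r` of the boundary of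
`C_D`, write a name of the boundary of `D` and a name of the boundary of `C_D`. -/
theorem mainTheorem2 :
    ∃ c c' : SphereTTE.OracleCode,
      ∀ (D C : Set SphereTTE.Sphere) (f : SphereTTE.Sphere → SphereTTE.Sphere) (n : ℕ),
        SphereTTE.IsSphereDomain D → SphereTTE.IsNConnected n D → SphereTTE.IsNondegenerate D →
        (∞ : SphereTTE.Sphere) ∈ D → ((0 : ℂ) : SphereTTE.Sphere) ∉ D →
        SphereTTE.IsKoebeMap D C f →
        ∀ p q r : ℕ → ℕ, SphereTTE.NamesOpen p D → SphereTTE.NamesFun q D f →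
          SphereTTE.NamesClosed r (frontier C) →
          (∃ s, c.Writes (SphereTTE.join (SphereTTE.join p fun _ => n) (SphereTTE.join q r)) s ∧
            SphereTTE.NamesClosed s (frontier D)) ∧
          (∃ s, c'.Writes (SphereTTE.join (SphereTTE.join p fun _ => n) (SphereTTE.join q r)) s ∧
            SphereTTE.NamesClosed s (frontier C)) := by
  obtain ⟨c, c', h⟩ := mainTheorem2_general
  exact ⟨c, c', fun D C f n hD _ _ hDinf _ hf p q r => h D C f p (fun _ => n) q r hD.1 hDinf hf.2.1
    (hf.2.2.map_infty (hf.2.1.1 ∞ hDinf).1)⟩
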